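/- Let $K\ge 3$, $\sigma>0$, $\tau\in\mathbb R$. A bandit problem consists of $K$ arms; arm $k\in\{1,\dots,K\}$ has a $\sigma^2$-sub-Gaussian distribution $\nu_k$ with mean $\mu_k$, i.e. $\mathbb E_{X\sim\nu_k}e^{t(X-\mu_k)}\le e^{\sigma^2t^2/2}$ for all $t\in\mathbb R$. Assume $\mu_1\le\tau\le\mu_K$. For a budget $T\in\mathbb N$ put $T_1=\lceil 6\log K\rceil$, $T_2=\lfloor T/(3T_1)\rfloor$ and $\varepsilon_0=\sqrt{2\sigma^2\log(48)/T_2}$. The algorithm MTB works as follows. Consider the binary tree with nodes $v=\{L,M,R\}$, $M=\lfloor (L+R)/2\rfloor$, and root $L=1$, $R=K$; the left child of $v$ has end points $L,M$, the right child has end points $M,R$; nodes with $R=L+1$ are leaves; the parent of the root is the root. *Explore.* Start at $v_1=$ root. In round $t=1,\dots,T_1$ draw $T_2$ fresh independent samples of each arm of $v_t=\{L,M,R\}$, and let $\hat\mu_{l,t},\hat\mu_{m,t},\hat\mu_{r,t}$ be the empirical means of the arms $L,M,R$. If $\tau\notin[\hat\mu_{l,t},\hat\mu_{r,t}]$, then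 $v_{t+1}$ is the parent of $v_t$; otherwise, if $v_t$ is a leaf, $v_{t+1}=v_t$; otherwise $v_{t+1}$ is the right child if $\hat\mu_{m,t}\le\tau\le\hat\mu_{r,t}$ and the left child if not. *Choose.* Let $\hat\varepsilon=2\varepsilon_0$ if in some round $v_t$ is a leaf with $\hat\mu_{l,t}\le\tau\le\hat\mu_{r,t}$, and $\hat\varepsilon=\max\bigl(2\varepsilon_0,\min_{t\le T_1,\,i\in\{l,m,r\}}|\hat\mu_{i,t}-\tau|\bigr)$ otherwise. In round $t$ the candidates are the positions $i\in\{l,m,r\}$ of $v_t$ with $|\hat\mu_{i,t}-\tau|\le\hat\varepsilon$, and also $i=r$ if $v_t$ is a leaf with $\hat\mu_{l,t}+\hat\varepsilon<\tau\le\hat\mu_{r,t}-\hat\varepsilon$. Each round that has a candidate appends the arm of exactly one candidate to a list $S$, ties being broken in an arbitrary, possibly random, way. The output $\hat k$ is a median of $S$ (either middle entry if $|S|$ is even), and the arms are classified by $\hat Q_k=1$ for $k\ge\hat k$, $\hat Q_k=-1$ for $k<\hat k$. The true classification is $Q_k=1$ if $\mu_k\ge\tau$ and $Q_k=-1$ otherwise,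 and the simple regret is $R_T=\max\{|\mu_k-\tau| : \hat Q_k\ne Q_k\}$, with $R_T=0$ if $\hat Q=Q$. **Proposition.** Let $T>6\log K$ with $T_2\ge 1$, let $\varepsilon\ge 3\varepsilon_0$, and suppose that the sequence $\bigl(\min(|\mu_k-\tau|,\varepsilon)\,\mathrm{sign}(\mu_k-\tau)\bigr)_{k\le K}$ is non-decreasing. Then MTB satisfies $$\mathbb P(R_T\ge\varepsilon)\le\min\Bigl(\exp\bigl(-\tfrac{3\log K}{4}\bigr),\ 72\log K\cdot\exp\Bigl(-\frac{T\varepsilon^2}{324\,\sigma^2\log K}\Bigr)\Bigr).$$ -/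

import Mathlib

open MeasureTheory ProbabilityTheory

noncomputable section

/-- The mean `μ_k` of the distribution of arm `k`. Arms are numbered from `0` to `K - 1`. -/
def armMean {K : ℕ} (ν : Fin K → Measure ℝ) (k : Fin K) : ℝ := ∫ x, x ∂(ν k)

/-- `ρ` is `σ²`-sub-Gaussian: `E[exp (t (X - μ))] ≤ exp (σ² t² / 2)` for all real `t`, where
`X` has law `ρ` and mean `μ`. -/
def IsSubGaussian (σ : ℝ) (ρ : Measure ℝ) : Prop :=
  HasSubgaussianMGF (fun x => x - ∫ y, y ∂ρ) (Real.toNNReal (σ ^ 2)) ρ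

/-- The number of rounds `T₁ = ⌈6 log K⌉` of the random walk on the tree. -/
def roundCount (K : ℕ) : ℕ := ⌈6 * Real.log K⌉₊

/-- The number of samples `T₂ = ⌊T / (3 T₁)⌋` of an arm of the current node in one round. -/
def pullCount (K T : ℕ) : ℕ := T / (3 * roundCount K)

/-- The constant `ε₀ = √(2 σ² log 48 / T₂)` (meaningful for `T₂ ≥ 1`). -/
def epsZero (σ : ℝ) (K T : ℕ) : ℝ := Real.sqrt (2 * σ ^ 2 * Real.log 48 / pullCount K T)

/-- A node `{L, M, R}` of the binary tree, given by its end points `L` and `R`; the middle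
`M = ⌊(L + R) / 2⌋` is `TreeNode.mid`. (Numbering the arms from `0` or from `1` gives the same
middle arm.) -/
structure TreeNode (K : ℕ) where
  left : Fin K
  right : Fin K

namespace TreeNode

variable {K : ℕ}

def mid (v : TreeNode K) : Fin K :=
  ⟨((v.left : ℕ) + v.right) / 2, by have := v.left.isLt; have := v.right.isLt; omega⟩

/-- The arms `v(l)`, `v(m)`, `v(r)` of a node, for the positions `0`, `1`, `2`. -/
def arm (v : TreeNode K) : Fin 3 → Fin K := ![v.left, v.mid, v.right]

/-- A leaf is a node with `R = L + 1`. -/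
def IsLeaf (v : TreeNode K) : Prop := (v.right : ℕ) = v.left + 1

def leftChild (v : TreeNode K) : TreeNode K := ⟨v.left, v.mid⟩

def rightChild (v : TreeNode K) : TreeNode K := ⟨v.mid, v.right⟩

/-- The root `{first arm, middle, last arm}`. -/
def root (K : ℕ) [NeZero K] : TreeNode K :=
  ⟨⟨0, Nat.pos_of_neZero K⟩, ⟨K - 1, Nat.sub_lt (Nat.pos_of_neZero K) Nat.one_pos⟩⟩

/-- The node reached from the root along a path. A path lists the directions taken, the last one
first (`true` for right, `false` for left); so the parent of the node at `p` sits at `p.tail`,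
and the parent of the root is the root. -/
def ofPath (K : ℕ) [NeZero K] : List Bool → TreeNode K
  | [] => root K
  | true :: p => (ofPath K p).rightChild
  | false :: p => (ofPath K p).leftChild

end TreeNode

section Algorithm

variable {K : ℕ}

open Classical in
/-- One step of `Explore` from the node at path `p`, when `m k` is the empirical mean of arm `k`
in the current round. -/
def exploreStep [NeZero K] (τ : ℝ) (m : Fin K → ℝ) (p : List Bool) : List Bool :=
  let v := TreeNode.ofPath K p
  if ¬ (m v.left ≤ τ ∧ τ ≤ m v.right) then p.tail
  else if v.IsLeaf then p
  else if m v.mid ≤ τ ∧ τ ≤ m v.right then true :: p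
  else false :: p

/-- The position of `Explore` in round `t` (rounds are `0, …, T₁ - 1`), when `m t k` is the
empirical mean of arm `k` in round `t`. Only the values of `m t` at the arms of the current node
matter. -/
def explorePath [NeZero K] (τ : ℝ) (m : ℕ → Fin K → ℝ) : ℕ → List Bool
  | 0 => []
  | t + 1 => exploreStep τ (m t) (explorePath τ m t)

/-- The node `v_t` visited by `Explore` in round `t`. -/
def exploreNode [NeZero K] (τ : ℝ) (m : ℕ → Fin K → ℝ) (t : ℕ) : TreeNode K :=
  TreeNode.ofPath K (explorePath τ m t)

open Classical in
/-- The positions of the node `v` that are candidates of `Choose` with parameter `e` : those whose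
empirical mean is within `e` of `τ`, and the right end of a leaf across which the empirical means
cross `τ` with margin `e`. -/
def candidates (τ e : ℝ) (m : Fin K → ℝ) (v : TreeNode K) : Finset (Fin 3) :=
  Finset.univ.filter fun i =>
    |m (v.arm i) - τ| ≤ e ∨
      (i = 2 ∧ v.IsLeaf ∧ m v.left + e < τ ∧ τ ≤ m v.right - e)

open Classical in
/-- The list built by `Choose` with parameter `e`: each round with a candidate contributes exactly
one of them, picked by the tie-breaking rule `sel` (round, set of candidates). -/
def chooseList [NeZero K] (τ e : ℝ) (m : ℕ → Fin K → ℝ) (sel : ℕ → Finset (Fin 3) → Fin 3) :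
    List (Fin K) :=
  (List.range (roundCount K)).filterMap fun t =>
    let v := exploreNode τ m t
    let C := candidates τ e (m t) v
    if C.Nonempty then some (v.arm (sel t C)) else none

/-- `x` is a median of the list `l`: an entry such that at most half of the entries are smaller
and at most half are larger. (For a list of even length, the two middle entries qualify.) -/
def IsMedian (l : List (Fin K)) (x : Fin K) : Prop :=
  x ∈ l ∧ 2 * l.countP (fun y => y < x) ≤ l.length ∧ 2 * l.countP (fun y => x < y) ≤ l.length

open Classical in
/-- The data-dependent parameter `ε̂` that `MTB` passes to `Choose`. -/
def epsHat [NeZero K] (τ e₀ : ℝ) (m : ℕ → Fin K → ℝ) : ℝ :=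
  if ∃ t < roundCount K, (exploreNode τ m t).IsLeaf ∧
      m t (exploreNode τ m t).left ≤ τ ∧ τ ≤ m t (exploreNode τ m t).right then
    2 * e₀
  else
    max (2 * e₀)
      (⨅ q : Fin (roundCount K) × Fin 3, |m q.1 ((exploreNode τ m q.1).arm q.2) - τ|)

/-- `khat` is the output of `MTB` on the empirical means `m`, with ties among the candidates
broken by `sel`: a median of the list of `Choose` run with parameter `ε̂`. -/
def IsMTBOutput [NeZero K] (τ e₀ : ℝ) (m : ℕ → Fin K → ℝ) (sel : ℕ → Finset (Fin 3) → Fin 3)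
    (khat : Fin K) : Prop :=
  IsMedian (chooseList τ (epsHat τ e₀ m) m sel) khat

/-- The empirical mean of arm `k` in round `t`, when `Y t k j` is the `j`-th sample of arm `k`
in round `t` and `n` samples are taken. -/
def empiricalMean (n : ℕ) (Y : ℕ → Fin K → ℕ → ℝ) (t : ℕ) (k : Fin K) : ℝ :=
  (∑ j ∈ Finset.range n, Y t k j) / n

open Classical in
/-- The true classification `Q`: `1` for the arms with mean at least `τ`, `-1` for the others. -/
def trueLabel (μ : Fin K → ℝ) (τ : ℝ) (k : Fin K) : ℤ := if τ ≤ μ k then 1 else -1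

/-- The classification `Q̂` that belongs to `khat`. -/
def thresholdLabel (khat k : Fin K) : ℤ := if khat ≤ k then 1 else -1

/-- The simple regret `max {|τ - μ_k| : Q̂_k ≠ Q_k}`, which is `0` if `Q̂ = Q`. -/
def simpleRegret (μ : Fin K → ℝ) (τ : ℝ) (Qhat : Fin K → ℤ) : ℝ :=
  ⨆ k : Fin K, if Qhat k ≠ trueLabel μ τ k then |τ - μ k| else 0

end Algorithm

end

noncomputable section

namespace MTB

variable {K : ℕ}

/-- Centered means `x` that cross zero from the first to the last arm and are non-decreasing once
truncated at level `ε`. -/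
structure Crossing [NeZero K] (x : Fin K → ℝ) (ε : ℝ) : Prop where
  two_le : 2 ≤ K
  eps_pos : 0 < ε
  mono : Monotone fun k => max (-ε) (min (x k) ε)
  first : x (TreeNode.root K).left ≤ 0
  last : 0 ≤ x (TreeNode.root K).right

/-- The arms to the right of the crossing: positive ones, and the last one. -/
def IsPos [NeZero K] (x : Fin K → ℝ) (k : Fin K) : Prop :=
  0 < x k ∨ k = (TreeNode.root K).right

section Arms

variable [NeZero K] {x : Fin K → ℝ} {ε c : ℝ} {i k : Fin K}

theorem Crossing.nonneg (h : Crossing x ε) (hk : IsPos x k) : 0 ≤ x k := by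
  rcases hk with hk | rfl
  · exact hk.le
  · exact h.last

theorem nonpos_of_not_isPos (hk : ¬ IsPos x k) : x k ≤ 0 := by
  by_contra hlt
  exact hk (Or.inl (not_le.mp hlt))

theorem Crossing.isPos_mono (h : Crossing x ε) (hik : i ≤ k) (hi : IsPos x i) : IsPos x k := by
  rcases hi with hi | rfl
  · left
    have h1 := h.mono hik
    have h2 := h.eps_pos
    simp only at h1
    by_contra hk
    have h3 : 0 < max (-ε) (min (x i) ε) := lt_max_of_lt_right (lt_min hi h2)
    have h4 : max (-ε) (min (x k) ε) ≤ 0 :=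
      max_le (by linarith) ((min_le_left _ _).trans (not_lt.mp hk))
    linarith
  · right
    apply le_antisymm _ hik
    rw [Fin.le_def]
    have := k.isLt
    simp only [TreeNode.root]
    omega

theorem Crossing.not_isPos_first (h : Crossing x ε) : ¬ IsPos x (TreeNode.root K).left := by
  rintro (h1 | h1)
  · exact absurd h.first (not_le.mpr h1)
  · have h2 := congrArg Fin.val h1
    have := h.two_le
    simp only [TreeNode.root] at h2
    omega

theorem isPos_last : IsPos x (TreeNode.root K).right := Or.inr rfl

theorem Crossing.abs_le_of_le_right (h : Crossing x ε) (hc : c < ε) (hik : i ≤ k) (hi : 0 ≤ x i)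
    (hk : |x k| ≤ c) : |x i| ≤ c := by
  have h1 := h.mono hik
  simp only at h1
  rw [abs_le] at hk
  rw [abs_of_nonneg hi]
  have h2 : max (-ε) (min (x k) ε) ≤ c := max_le (by linarith) ((min_le_left _ _).trans hk.2)
  have h3 := (le_max_right _ _).trans (h1.trans h2)
  rcases min_le_iff.mp h3 with h4 | h4
  · exact h4
  · linarith

theorem Crossing.abs_le_of_le_left (h : Crossing x ε) (hc : c < ε) (hik : i ≤ k) (hk : x k ≤ 0)
    (hi : |x i| ≤ c) : |x k| ≤ c := by
  have h1 := h.mono hik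
  simp only at h1
  rw [abs_le] at hi
  rw [abs_of_nonpos hk]
  have h2 : -c ≤ max (-ε) (min (x i) ε) := le_max_of_le_right (le_min hi.1 (by linarith))
  rcases le_max_iff.mp (h2.trans h1) with h4 | h4
  · linarith
  · linarith [h4.trans (min_le_left _ _)]

theorem Crossing.low_of_le (h : Crossing x ε) (hik : i ≤ k) (hk : x k ≤ -ε) : x i ≤ -ε := by
  have h1 := h.mono hik
  simp only at h1
  have h2 : max (-ε) (min (x k) ε) ≤ -ε := max_le le_rfl ((min_le_left _ _).trans hk)
  rcases min_le_iff.mp ((le_max_right _ _).trans (h1.trans h2)) with h4 | h4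
  · exact h4
  · linarith [h.eps_pos]

theorem Crossing.high_of_le (h : Crossing x ε) (hik : i ≤ k) (hi : ε ≤ x i) : ε ≤ x k := by
  have h1 := h.mono hik
  simp only at h1
  have h2 : ε ≤ max (-ε) (min (x i) ε) := le_max_of_le_right (le_min hi le_rfl)
  rcases le_max_iff.mp (h2.trans h1) with h4 | h4
  · linarith [h.eps_pos]
  · exact h4.trans (min_le_left _ _)

end Arms

section Node

@[simp] theorem arm_zero (v : TreeNode K) : v.arm 0 = v.left := rfl
@[simp] theorem arm_one (v : TreeNode K) : v.arm 1 = v.mid := rfl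
@[simp] theorem arm_two (v : TreeNode K) : v.arm 2 = v.right := rfl

theorem left_le_mid {v : TreeNode K} (hv : v.left < v.right) : v.left ≤ v.mid := by
  rw [Fin.lt_def] at hv
  rw [Fin.le_def]
  simp only [TreeNode.mid]
  omega

theorem mid_lt_right {v : TreeNode K} (hv : v.left < v.right) : v.mid < v.right := by
  rw [Fin.lt_def] at hv ⊢
  simp only [TreeNode.mid]
  omega

theorem left_lt_mid {v : TreeNode K} (hv : v.left < v.right) (hl : ¬ v.IsLeaf) :
    v.left < v.mid := by
  rw [Fin.lt_def] at hv ⊢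
  simp only [TreeNode.mid, TreeNode.IsLeaf] at *
  omega

end Node

/-- The paths whose proper initial segments do not end in a leaf. -/
def ValidPath (K : ℕ) [NeZero K] : List Bool → Prop
  | [] => True
  | _ :: p => ValidPath K p ∧ ¬ (TreeNode.ofPath K p).IsLeaf

section Tree

variable [NeZero K] {x : Fin K → ℝ} {ε c : ℝ} {p : List Bool} {b : Bool}

theorem ValidPath.left_lt_right (hK : 2 ≤ K) :
    ∀ {p : List Bool}, ValidPath K p → (TreeNode.ofPath K p).left < (TreeNode.ofPath K p).right
  | [], _ => by
    simp only [TreeNode.ofPath, TreeNode.root, Fin.lt_def]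
    omega
  | true :: p, h => mid_lt_right (ValidPath.left_lt_right hK h.1)
  | false :: p, h => left_lt_mid (ValidPath.left_lt_right hK h.1) h.2

theorem ValidPath.tail : ∀ {p : List Bool}, ValidPath K p → ValidPath K p.tail
  | [], h => h
  | _ :: _, h => h.1

/-- The node has the crossing between its end points. -/
def OnPath (x : Fin K → ℝ) (v : TreeNode K) : Prop := ¬ IsPos x v.left ∧ IsPos x v.right

open Classical in
/-- The step that `Explore` takes when all signs are observed correctly. -/
def trueStep (x : Fin K → ℝ) (p : List Bool) : List Bool :=
  let v := TreeNode.ofPath K p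
  if ¬ OnPath x v then p.tail
  else if v.IsLeaf then p
  else if ¬ IsPos x v.mid then true :: p
  else false :: p

/-- A node is a target if one of its arms is within `c` of zero, or if it is the leaf of the
crossing. -/
def IsTarget (x : Fin K → ℝ) (c : ℝ) (p : List Bool) : Prop :=
  (∃ i, |x ((TreeNode.ofPath K p).arm i)| ≤ c) ∨
    ((TreeNode.ofPath K p).IsLeaf ∧ OnPath x (TreeNode.ofPath K p))

/-- The number of correct steps from the node at `p` to the set of targets. -/
def targetDist (x : Fin K → ℝ) (c : ℝ) (p : List Bool) : ℕ :=
  sInf {n | IsTarget x c ((trueStep x)^[n] p)}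

theorem trueStep_of_not_onPath (h : ¬ OnPath x (TreeNode.ofPath K p)) :
    trueStep x p = p.tail := by
  simp [trueStep, h]

theorem trueStep_right (h : OnPath x (TreeNode.ofPath K p)) (hl : ¬ (TreeNode.ofPath K p).IsLeaf)
    (hm : ¬ IsPos x (TreeNode.ofPath K p).mid) : trueStep x p = true :: p := by
  simp [trueStep, h, hl, hm]

theorem trueStep_left (h : OnPath x (TreeNode.ofPath K p)) (hl : ¬ (TreeNode.ofPath K p).IsLeaf)
    (hm : IsPos x (TreeNode.ofPath K p).mid) : trueStep x p = false :: p := by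
  simp [trueStep, h, hl, hm]

theorem isTarget_iff : IsTarget x c p ↔
    (|x (TreeNode.ofPath K p).left| ≤ c ∨ |x (TreeNode.ofPath K p).mid| ≤ c ∨
      |x (TreeNode.ofPath K p).right| ≤ c) ∨
    ((TreeNode.ofPath K p).IsLeaf ∧ OnPath x (TreeNode.ofPath K p)) := by
  simp [IsTarget, Fin.exists_fin_succ]

theorem ofPath_true : TreeNode.ofPath K (true :: p) = (TreeNode.ofPath K p).rightChild := rfl
theorem ofPath_false : TreeNode.ofPath K (false :: p) = (TreeNode.ofPath K p).leftChild := rfl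

/-- If a child has the crossing, then so has its parent, and the correct step leads to the
child. -/
theorem Crossing.trueStep_of_child (h : Crossing x ε) (hp : ValidPath K (b :: p))
    (hb : OnPath x (TreeNode.ofPath K (b :: p))) :
    OnPath x (TreeNode.ofPath K p) ∧ trueStep x p = b :: p := by
  have hlt := ValidPath.left_lt_right h.two_le hp.1
  cases b
  · rw [ofPath_false] at hb
    have h1 : OnPath x (TreeNode.ofPath K p) :=
      ⟨hb.1, h.isPos_mono (mid_lt_right hlt).le hb.2⟩
    exact ⟨h1, trueStep_left h1 hp.2 hb.2⟩
  · rw [ofPath_true] at hb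
    have h1 : OnPath x (TreeNode.ofPath K p) :=
      ⟨fun h' => hb.1 (h.isPos_mono (left_le_mid hlt) h'), hb.2⟩
    exact ⟨h1, trueStep_right h1 hp.2 hb.1⟩

theorem Crossing.isTarget_child (h : Crossing x ε) (hc : c < ε) (hp : ValidPath K (b :: p))
    (hb : OnPath x (TreeNode.ofPath K (b :: p))) (ht : IsTarget x c p) :
    IsTarget x c (b :: p) := by
  have hlt := ValidPath.left_lt_right h.two_le hp.1
  rw [isTarget_iff] at ht
  rcases ht with ht | ht
  swap
  · exact absurd ht.1 hp.2
  cases b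
  · rw [ofPath_false] at hb
    suffices |x (TreeNode.ofPath K p).left| ≤ c ∨ |x (TreeNode.ofPath K p).mid| ≤ c by
      rw [isTarget_iff, ofPath_false]
      rcases this with h1 | h1
      · exact Or.inl (Or.inl h1)
      · exact Or.inl (Or.inr (Or.inr h1))
    rcases ht with ht | ht | ht
    · exact Or.inl ht
    · exact Or.inr ht
    · exact Or.inr (h.abs_le_of_le_right hc (mid_lt_right hlt).le (h.nonneg hb.2) ht)
  · rw [ofPath_true] at hb
    suffices |x (TreeNode.ofPath K p).mid| ≤ c ∨ |x (TreeNode.ofPath K p).right| ≤ c by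
      rw [isTarget_iff, ofPath_true]
      rcases this with h1 | h1
      · exact Or.inl (Or.inl h1)
      · exact Or.inl (Or.inr (Or.inr h1))
    rcases ht with ht | ht | ht
    · exact Or.inl (h.abs_le_of_le_left hc (left_le_mid hlt) (nonpos_of_not_isPos hb.1) ht)
    · exact Or.inl ht
    · exact Or.inr ht

theorem isTarget_parent (ht : |x (TreeNode.ofPath K p).left| ≤ c ∨
    |x (TreeNode.ofPath K p).right| ≤ c) : IsTarget x c p.tail := by
  rw [isTarget_iff]
  match p, ht with
  | [], ht => exact Or.inl (ht.elim Or.inl fun h => Or.inr (Or.inr h))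
  | true :: p, ht => exact Or.inl (ht.elim (fun h => Or.inr (Or.inl h)) fun h => Or.inr (Or.inr h))
  | false :: p, ht => exact Or.inl (ht.elim Or.inl fun h => Or.inr (Or.inl h))

/-- Off the crossing, a target is left through a common end point. -/
theorem Crossing.isTarget_tail (h : Crossing x ε) (hc : c < ε) (hp : ValidPath K p)
    (hb : ¬ OnPath x (TreeNode.ofPath K p)) (ht : IsTarget x c p) : IsTarget x c p.tail := by
  have hlt := ValidPath.left_lt_right h.two_le hp
  rw [isTarget_iff] at ht
  rcases ht with ht | ht
  swap
  · exact absurd ht.2 hb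
  apply isTarget_parent
  rcases ht with ht | ht | ht
  · exact Or.inl ht
  · by_cases h1 : IsPos x (TreeNode.ofPath K p).left
    · exact Or.inl (h.abs_le_of_le_right hc (left_le_mid hlt) (h.nonneg h1) ht)
    · have h2 : ¬ IsPos x (TreeNode.ofPath K p).right := fun h2 => hb ⟨h1, h2⟩
      exact Or.inr (h.abs_le_of_le_left hc (mid_lt_right hlt).le (nonpos_of_not_isPos h2) ht)
  · exact Or.inr ht

theorem Crossing.exists_isTarget_of_le (h : Crossing x ε) (d : ℕ) :
    ∀ {p : List Bool}, ValidPath K p → OnPath x (TreeNode.ofPath K p) →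
      ((TreeNode.ofPath K p).right : ℕ) ≤ (TreeNode.ofPath K p).left + 2 ^ d →
      ∃ n ≤ d, IsTarget x c ((trueStep x)^[n] p) := by
  induction d with
  | zero =>
    intro p hp ho hd
    have hlt := ValidPath.left_lt_right h.two_le hp
    rw [Fin.lt_def] at hlt
    have hl : (TreeNode.ofPath K p).IsLeaf := by
      simp only [TreeNode.IsLeaf]
      omega
    exact ⟨0, le_rfl, Or.inr ⟨hl, ho⟩⟩
  | succ d ih =>
    intro p hp ho hd
    have hlt := ValidPath.left_lt_right h.two_le hp
    by_cases hl : (TreeNode.ofPath K p).IsLeaf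
    · exact ⟨0, Nat.zero_le _, Or.inr ⟨hl, ho⟩⟩
    rw [pow_succ] at hd
    rw [Fin.lt_def] at hlt
    by_cases hm : IsPos x (TreeNode.ofPath K p).mid
    · obtain ⟨n, hn, hn'⟩ := ih (p := false :: p) ⟨hp, hl⟩ ⟨ho.1, hm⟩ (by
        simp only [ofPath_false, TreeNode.leftChild, TreeNode.mid]
        omega)
      refine ⟨n + 1, by omega, ?_⟩
      rwa [Function.iterate_succ_apply, trueStep_left ho hl hm]
    · obtain ⟨n, hn, hn'⟩ := ih (p := true :: p) ⟨hp, hl⟩ ⟨hm, ho.2⟩ (by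
        simp only [ofPath_true, TreeNode.rightChild, TreeNode.mid]
        omega)
      refine ⟨n + 1, by omega, ?_⟩
      rwa [Function.iterate_succ_apply, trueStep_right ho hl hm]

theorem Crossing.exists_isTarget (h : Crossing x ε) :
    ∀ {p : List Bool}, ValidPath K p → ∃ n, IsTarget x c ((trueStep x)^[n] p) := by
  intro p
  induction p with
  | nil =>
    intro hp
    obtain ⟨n, -, hn⟩ := h.exists_isTarget_of_le (c := c) K hp ⟨h.not_isPos_first, isPos_last⟩ (by
      have h1 := (TreeNode.ofPath K []).right.isLt
      have h2 := @Nat.lt_two_pow_self K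
      exact (h1.trans h2).le.trans (Nat.le_add_left _ _))
    exact ⟨n, hn⟩
  | cons b p ih =>
    intro hp
    by_cases ho : OnPath x (TreeNode.ofPath K (b :: p))
    · obtain ⟨n, -, hn⟩ := h.exists_isTarget_of_le (c := c) K hp ho (by
        have h1 := (TreeNode.ofPath K (b :: p)).right.isLt
        have h2 := @Nat.lt_two_pow_self K
        exact (h1.trans h2).le.trans (Nat.le_add_left _ _))
      exact ⟨n, hn⟩
    · obtain ⟨n, hn⟩ := ih hp.1
      refine ⟨n + 1, ?_⟩
      rwa [Function.iterate_succ_apply, trueStep_of_not_onPath ho]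

theorem targetDist_le {n : ℕ} (hn : IsTarget x c ((trueStep x)^[n] p)) : targetDist x c p ≤ n :=
  Nat.sInf_le hn

theorem targetDist_eq_zero (ht : IsTarget x c p) : targetDist x c p = 0 :=
  Nat.le_zero.mp (targetDist_le (n := 0) ht)

theorem Crossing.isTarget_iterate_targetDist (h : Crossing x ε) (hp : ValidPath K p) :
    IsTarget x c ((trueStep x)^[targetDist x c p] p) :=
  Nat.sInf_mem (h.exists_isTarget hp)

theorem Crossing.targetDist_root_le (h : Crossing x ε) :
    targetDist x c [] ≤ Nat.clog 2 (K - 1) := by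
  obtain ⟨n, hn, hn'⟩ := h.exists_isTarget_of_le (p := []) (c := c) (Nat.clog 2 (K - 1)) trivial
    ⟨h.not_isPos_first, isPos_last⟩ (by
      have := Nat.le_pow_clog (b := 2) (by norm_num) (K - 1)
      simp only [TreeNode.ofPath, TreeNode.root]
      omega)
  exact (targetDist_le hn').trans hn

theorem validPath_trueStep (hp : ValidPath K p) : ValidPath K (trueStep x p) := by
  unfold trueStep
  dsimp only
  split_ifs with h1 h2 h3
  · exact hp
  · exact ⟨hp, h2⟩
  · exact ⟨hp, h2⟩
  · exact hp.tail

theorem Crossing.targetDist_le_trueStep (h : Crossing x ε) (hp : ValidPath K p) :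
    targetDist x c p ≤ targetDist x c (trueStep x p) + 1 := by
  apply targetDist_le
  rw [Function.iterate_succ_apply]
  exact h.isTarget_iterate_targetDist (validPath_trueStep hp)

theorem Crossing.targetDist_trueStep_lt (h : Crossing x ε) (hp : ValidPath K p)
    (ht : ¬ IsTarget x c p) : targetDist x c (trueStep x p) + 1 ≤ targetDist x c p := by
  have h1 := h.isTarget_iterate_targetDist (c := c) hp
  obtain ⟨n, hn⟩ : ∃ n, targetDist x c p = n + 1 := by
    apply Nat.exists_eq_succ_of_ne_zero
    intro h0
    rw [h0] at h1
    exact ht h1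
  rw [hn, Function.iterate_succ_apply] at h1
  rw [hn]
  exact Nat.succ_le_succ (targetDist_le h1)

theorem Crossing.targetDist_cons_le (h : Crossing x ε) (hc : c < ε) (hp : ValidPath K (b :: p)) :
    targetDist x c (b :: p) ≤ targetDist x c p + 1 := by
  by_cases ho : OnPath x (TreeNode.ofPath K (b :: p))
  · obtain ⟨-, h2⟩ := h.trueStep_of_child hp ho
    by_cases ht : IsTarget x c p
    · rw [targetDist_eq_zero (h.isTarget_child hc hp ho ht)]
      exact Nat.zero_le _
    · have := h.targetDist_trueStep_lt hp.1 ht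
      rw [h2] at this
      omega
  · have := h.targetDist_le_trueStep (c := c) hp
    rwa [trueStep_of_not_onPath ho] at this

theorem Crossing.targetDist_tail_le (h : Crossing x ε) (hc : c < ε) (hp : ValidPath K p) :
    targetDist x c p.tail ≤ targetDist x c p + 1 := by
  cases p with
  | nil => exact Nat.le_succ _
  | cons b p =>
    by_cases ho : OnPath x (TreeNode.ofPath K (b :: p))
    · obtain ⟨-, h2⟩ := h.trueStep_of_child hp ho
      have := h.targetDist_le_trueStep (c := c) hp.1
      rwa [h2] at this
    · by_cases ht : IsTarget x c (b :: p)
      · rw [targetDist_eq_zero (h.isTarget_tail hc hp ho ht)]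
        exact Nat.zero_le _
      · have := h.targetDist_trueStep_lt hp ht
        rw [trueStep_of_not_onPath ho] at this
        omega

end Tree

section Step

variable [NeZero K] {x : Fin K → ℝ} {ε c τ : ℝ} {p : List Bool} {m : Fin K → ℝ}

theorem validPath_exploreStep (hp : ValidPath K p) : ValidPath K (exploreStep τ m p) := by
  unfold exploreStep
  dsimp only
  split_ifs with h1 h2 h3
  · exact hp
  · exact ⟨hp, h2⟩
  · exact ⟨hp, h2⟩
  · exact hp.tail

theorem validPath_explorePath (m : ℕ → Fin K → ℝ) (t : ℕ) :
    ValidPath K (explorePath τ m t) := by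
  induction t with
  | zero => trivial
  | succ t ih => exact validPath_exploreStep ih

theorem Crossing.targetDist_exploreStep_le (h : Crossing x ε) (hc : c < ε) (hp : ValidPath K p) :
    targetDist x c (exploreStep τ m p) ≤ targetDist x c p + 1 := by
  unfold exploreStep
  dsimp only
  split_ifs with h1 h2 h3
  · exact Nat.le_succ _
  · exact h.targetDist_cons_le hc ⟨hp, h2⟩
  · exact h.targetDist_cons_le hc ⟨hp, h2⟩
  · exact h.targetDist_tail_le hc hp

/-- The observation `y` of arm `k` lies strictly on the correct side of `τ`. -/
def SignRight (x : Fin K → ℝ) (τ : ℝ) (k : Fin K) (y : ℝ) : Prop :=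
  (IsPos x k → τ < y) ∧ (¬ IsPos x k → y < τ)

theorem SignRight.le_iff {k : Fin K} {y : ℝ} (h : SignRight x τ k y) : y ≤ τ ↔ ¬ IsPos x k :=
  ⟨fun h1 h2 => absurd (h.1 h2) (not_lt.mpr h1), fun h1 => (h.2 h1).le⟩

theorem SignRight.ge_iff {k : Fin K} {y : ℝ} (h : SignRight x τ k y) : τ ≤ y ↔ IsPos x k :=
  ⟨fun h1 => by_contra fun h2 => absurd (h.2 h2) (not_lt.mpr h1), fun h1 => (h.1 h1).le⟩

theorem exploreStep_eq_trueStep (hl : SignRight x τ (TreeNode.ofPath K p).left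
      (m (TreeNode.ofPath K p).left))
    (hm : SignRight x τ (TreeNode.ofPath K p).mid (m (TreeNode.ofPath K p).mid))
    (hr : SignRight x τ (TreeNode.ofPath K p).right (m (TreeNode.ofPath K p).right)) :
    exploreStep τ m p = trueStep x p := by
  have h1 := hl.le_iff
  have h2 := hr.ge_iff
  have h3 := hm.le_iff
  unfold exploreStep trueStep OnPath
  dsimp only
  by_cases hL : IsPos x (TreeNode.ofPath K p).left
  · rw [if_pos (fun h => h1.mp h.1 hL), if_pos (fun h => h.1 hL)]
  by_cases hR : IsPos x (TreeNode.ofPath K p).right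
  swap
  · rw [if_pos (fun h => hR (h2.mp h.2)), if_pos (fun h => hR h.2)]
  rw [if_neg (not_not.mpr ⟨h1.mpr hL, h2.mpr hR⟩), if_neg (not_not.mpr ⟨hL, hR⟩)]
  by_cases hM : IsPos x (TreeNode.ofPath K p).mid
  · rw [if_neg (fun h : _ ∧ _ => h3.mp h.1 hM), if_neg (not_not.mpr hM)]
  · rw [if_pos (⟨h3.mpr hM, h2.mpr hR⟩ : _ ∧ _), if_pos hM]

theorem Crossing.targetDist_exploreStep_lt (h : Crossing x ε) (hp : ValidPath K p)
    (ht : ¬ IsTarget x c p)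
    (hs : ∀ i, c < |x ((TreeNode.ofPath K p).arm i)| →
      SignRight x τ ((TreeNode.ofPath K p).arm i) (m ((TreeNode.ofPath K p).arm i))) :
    targetDist x c (exploreStep τ m p) + 1 ≤ targetDist x c p := by
  have h1 : ∀ i, c < |x ((TreeNode.ofPath K p).arm i)| := fun i =>
    not_le.mp fun h2 => ht (Or.inl ⟨i, h2⟩)
  rw [exploreStep_eq_trueStep (hs 0 (h1 0)) (hs 1 (h1 1)) (hs 2 (h1 2))]
  exact h.targetDist_trueStep_lt hp ht

theorem Crossing.isTarget_exploreStep (h : Crossing x ε) (hc : c < ε) (hp : ValidPath K p)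
    (ht : IsTarget x c p)
    (hs : ∀ i, c < |x ((TreeNode.ofPath K p).arm i)| →
      SignRight x τ ((TreeNode.ofPath K p).arm i) (m ((TreeNode.ofPath K p).arm i))) :
    IsTarget x c (exploreStep τ m p) := by
  have hlt := ValidPath.left_lt_right h.two_le hp
  have hL := hs 0
  have hM := hs 1
  have hR := hs 2
  simp only [arm_zero, arm_one, arm_two] at hL hM hR
  by_cases hn : ∃ i, |x ((TreeNode.ofPath K p).arm i)| ≤ c
  swap
  · have hn' : ∀ i, c < |x ((TreeNode.ofPath K p).arm i)| := fun i =>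
      not_le.mp fun h2 => hn ⟨i, h2⟩
    have ht' := ht.resolve_left hn
    rw [exploreStep_eq_trueStep (hL (hn' 0)) (hM (hn' 1)) (hR (hn' 2))]
    have : trueStep x p = p := by simp [trueStep, ht'.1, ht'.2]
    rwa [this]
  rw [isTarget_iff] at ht
  set v := TreeNode.ofPath K p with hv
  have hn3 : |x v.left| ≤ c ∨ |x v.mid| ≤ c ∨ |x v.right| ≤ c := by
    simpa [Fin.exists_fin_succ] using hn
  unfold exploreStep
  dsimp only
  rw [← hv]
  split_ifs with h1 h2 h3
  · exact Or.inl (by simpa [Fin.exists_fin_succ, ← hv] using hn3)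
  · suffices |x v.mid| ≤ c ∨ |x v.right| ≤ c by
      rw [isTarget_iff, ofPath_true]
      rcases this with h1 | h1
      · exact Or.inl (Or.inl h1)
      · exact Or.inl (Or.inr (Or.inr h1))
    by_contra! hcon
    have hnear := hn3.resolve_right (by push Not; exact hcon)
    have h4 := (hM hcon.1).le_iff.mp h3.1
    have := h.abs_le_of_le_left hc (left_le_mid hlt) (nonpos_of_not_isPos h4) hnear
    linarith [hcon.1]
  · suffices |x v.left| ≤ c ∨ |x v.mid| ≤ c by
      rw [isTarget_iff, ofPath_false]
      rcases this with h1 | h1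
      · exact Or.inl (Or.inl h1)
      · exact Or.inl (Or.inr (Or.inr h1))
    by_contra! hcon
    have hnear : |x v.right| ≤ c := by
      rcases hn3 with h5 | h5 | h5
      · linarith [hcon.1]
      · linarith [hcon.2]
      · exact h5
    have h4 : IsPos x v.mid := by
      by_contra h5
      exact h3 ⟨(hM hcon.2).le_iff.mpr h5, h1.2⟩
    have := h.abs_le_of_le_right hc (mid_lt_right hlt).le (h.nonneg h4) hnear
    linarith [hcon.2]
  · apply isTarget_parent
    rw [← hv]
    by_contra! hcon
    have hnear : |x v.mid| ≤ c := by
      rcases hn3 with h5 | h5 | h5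
      · linarith [hcon.1]
      · exact h5
      · linarith [hcon.2]
    have h4 : ¬ IsPos x v.left := by
      intro h5
      have := h.abs_le_of_le_right hc (left_le_mid hlt) (h.nonneg h5) hnear
      linarith [hcon.1]
    have h6 : IsPos x v.right := by
      by_contra h5
      have := h.abs_le_of_le_left hc (mid_lt_right hlt).le (nonpos_of_not_isPos h5) hnear
      linarith [hcon.2]
    exact h1 ⟨(hL hcon.1).le_iff.mpr h4, (hR hcon.2).ge_iff.mpr h6⟩

end Step

end MTB

end

noncomputable section

namespace MTB

variable {K : ℕ}

/-- The arms that must not be the output: those below `-ε`, and those that have an arm above `ε`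
to their left. -/
def IsBad (x : Fin K → ℝ) (ε : ℝ) (k : Fin K) : Prop := x k ≤ -ε ∨ ∃ h < k, ε ≤ x h

section Surplus

variable {x : Fin K → ℝ} {ε : ℝ} {Hit Flip : Fin K → ℝ → Prop}

open Classical in
/-- The contribution of an entry to the surplus of the entries that are not bad. -/
def gain (x : Fin K → ℝ) (ε : ℝ) : Option (Fin K) → ℤ
  | none => 0
  | some k => if IsBad x ε k then -1 else 1

open Classical in
theorem countP_sub_countP_filterMap (f : ℕ → Option (Fin K)) (t : ℕ) :
    ((((List.range t).filterMap f).countP (fun y => ¬ IsBad x ε y) : ℕ) : ℤ) -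
      (((List.range t).filterMap f).countP (fun y => IsBad x ε y) : ℕ) =
      ∑ s ∈ Finset.range t, gain x ε (f s) := by
  induction t with
  | zero => simp
  | succ t ih =>
    rw [Finset.sum_range_succ, ← ih, List.range_succ, List.filterMap_append]
    rcases hf : f t with _ | k
    · simp [hf, gain]
    · by_cases hk : IsBad x ε k
      · simp [hf, gain, hk]
        ring
      · simp [hf, gain, hk]
        ring

theorem neg_one_le_gain (o : Option (Fin K)) : -1 ≤ gain x ε o := by
  classical
  rcases o with _ | k
  · simp [gain]
  · unfold gain
    dsimp only
    split_ifs <;> norm_num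

open Classical in
/-- The severity of the misleading observations at the node `v`. -/
def hitLevel (Hit Flip : Fin K → ℝ → Prop) (v : TreeNode K) (m : Fin K → ℝ) : ℕ :=
  if (∃ i j, v.arm i ≠ v.arm j ∧ Hit (v.arm i) (m (v.arm i)) ∧ Hit (v.arm j) (m (v.arm j))) ∨
      ∃ i, Flip (v.arm i) (m (v.arm i)) then 2
  else if ∃ i, Hit (v.arm i) (m (v.arm i)) then 1 else 0

theorem hitLevel_le_two (v : TreeNode K) (m : Fin K → ℝ) : hitLevel Hit Flip v m ≤ 2 := by
  classical
  unfold hitLevel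
  split_ifs <;> norm_num

end Surplus

section Output

variable [NeZero K] {x : Fin K → ℝ} {ε τ e : ℝ} {k : Fin K}

theorem Crossing.far_of_isBad (h : Crossing x ε) (hk : IsBad x ε k) : ε ≤ |x k| := by
  rcases hk with hk | ⟨i, hi, hi'⟩
  · exact le_abs.mpr (Or.inr (by linarith))
  · exact le_abs.mpr (Or.inl (h.high_of_le hi.le hi'))

theorem Crossing.isBad_of_le_simpleRegret {μ : Fin K → ℝ} (h : Crossing (fun k => μ k - τ) ε)
    (hR : ε ≤ simpleRegret μ τ (thresholdLabel k)) : IsBad (fun k => μ k - τ) ε k := by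
  classical
  obtain ⟨i, hi⟩ := exists_eq_ciSup_of_finite
    (f := fun i : Fin K => if thresholdLabel k i ≠ trueLabel μ τ i then |τ - μ i| else 0)
  have hi2 : ε ≤ if thresholdLabel k i ≠ trueLabel μ τ i then |τ - μ i| else 0 :=
    hR.trans (by rw [hi]; rfl)
  split_ifs at hi2 with hne
  swap
  · exact absurd h.eps_pos (not_lt.mpr hi2)
  unfold thresholdLabel trueLabel at hne
  rw [abs_sub_comm] at hi2
  by_cases h1 : k ≤ i
  · by_cases h2 : τ ≤ μ i
    · simp [h1, h2] at hne
    · left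
      apply h.low_of_le h1
      rw [abs_of_neg (by linarith)] at hi2
      linarith
  · by_cases h2 : τ ≤ μ i
    · right
      refine ⟨i, not_le.mp h1, ?_⟩
      rwa [abs_of_nonneg (by linarith)] at hi2
    · simp [h1, h2] at hne

open Classical in
theorem Crossing.countP_le_of_isMedian (h : Crossing x ε) {l : List (Fin K)} (hm : IsMedian l k)
    (hk : IsBad x ε k) :
    l.countP (fun y => ¬ IsBad x ε y) ≤ l.countP (fun y => IsBad x ε y) := by
  have h1 : l.length = l.countP (fun y => IsBad x ε y) + l.countP (fun y => ¬ IsBad x ε y) := by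
    have := List.length_eq_countP_add_countP (fun y => decide (IsBad x ε y)) (l := l)
    simpa using this
  suffices 2 * l.countP (fun y => ¬ IsBad x ε y) ≤ l.length by omega
  rcases hk with hk | ⟨i, hi, hi'⟩
  · refine le_trans (Nat.mul_le_mul_left 2 (List.countP_mono_left ?_)) hm.2.2
    intro y _ hy
    simp only [decide_eq_true_eq] at hy ⊢
    by_contra hle
    exact hy (Or.inl (h.low_of_le (not_lt.mp hle) hk))
  · refine le_trans (Nat.mul_le_mul_left 2 (List.countP_mono_left ?_)) hm.2.1
    intro y _ hy
    simp only [decide_eq_true_eq] at hy ⊢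
    by_contra hle
    exact hy (Or.inr ⟨i, hi.trans_le (not_lt.mp hle), hi'⟩)

open Classical in
/-- The entry that round `t` contributes to the list of `Choose`. -/
def roundEntry (τ e : ℝ) (m : ℕ → Fin K → ℝ) (sel : ℕ → Finset (Fin 3) → Fin 3) (t : ℕ) :
    Option (Fin K) :=
  let v := exploreNode τ m t
  let C := candidates τ e (m t) v
  if C.Nonempty then some (v.arm (sel t C)) else none

theorem chooseList_eq (m : ℕ → Fin K → ℝ) (sel : ℕ → Finset (Fin 3) → Fin 3) :
    chooseList τ e m sel = (List.range (roundCount K)).filterMap (roundEntry τ e m sel) := rfl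

end Output

/-- `Hit k y` holds whenever the observation `y` of arm `k` is misleading: it is off the window of
a near arm, on the wrong side for another arm, or in the window for a far arm. `Flip k y` holds
whenever a far arm is seen on the wrong side. -/
structure HitSpec [NeZero K] (x : Fin K → ℝ) (e₀ ε τ : ℝ) (Hit Flip : Fin K → ℝ → Prop) :
    Prop where
  near : ∀ k y, |x k| ≤ e₀ → ¬ Hit k y → |y - τ| ≤ 2 * e₀
  sign : ∀ k y, e₀ < |x k| → ¬ Hit k y → SignRight x τ k y
  far : ∀ k y, ε ≤ |x k| → ¬ Hit k y → 2 * e₀ < |y - τ|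
  flip : ∀ k y, ε ≤ |x k| → ¬ Flip k y → SignRight x τ k y
  hit_of_flip : ∀ k y, Flip k y → Hit k y ∧ ε ≤ |x k|

section Rounds

variable [NeZero K] {x : Fin K → ℝ} {e₀ ε τ e : ℝ} {Hit Flip : Fin K → ℝ → Prop}
  {m : ℕ → Fin K → ℝ} {sel : ℕ → Finset (Fin 3) → Fin 3} {t : ℕ}

theorem roundEntry_eq_some {k : Fin K} (hsel : ∀ t C, C.Nonempty → sel t C ∈ C)
    (h : roundEntry τ e m sel t = some k) :
    ∃ i, k = (exploreNode τ m t).arm i ∧ (|m t k - τ| ≤ e ∨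
      (i = 2 ∧ (exploreNode τ m t).IsLeaf ∧ m t (exploreNode τ m t).left + e < τ ∧
        τ ≤ m t (exploreNode τ m t).right - e)) := by
  classical
  unfold roundEntry at h
  dsimp only at h
  split_ifs at h with hC
  have h1 := hsel t _ hC
  rw [Option.some.injEq] at h
  unfold candidates at h1
  rw [Finset.mem_filter] at h1
  refine ⟨_, h.symm, ?_⟩
  rw [← h]
  exact h1.2

theorem exists_roundEntry {i : Fin 3} (h : |m t ((exploreNode τ m t).arm i) - τ| ≤ e ∨
      (i = 2 ∧ (exploreNode τ m t).IsLeaf ∧ m t (exploreNode τ m t).left + e < τ ∧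
        τ ≤ m t (exploreNode τ m t).right - e)) : ∃ k, roundEntry τ e m sel t = some k := by
  classical
  have : (candidates τ e (m t) (exploreNode τ m t)).Nonempty := by
    refine ⟨i, ?_⟩
    unfold candidates
    rw [Finset.mem_filter]
    exact ⟨Finset.mem_univ _, h⟩
  unfold roundEntry
  dsimp only
  rw [if_pos this]
  exact ⟨_, rfl⟩

theorem explorePath_succ : explorePath τ m (t + 1) = exploreStep τ (m t) (explorePath τ m t) :=
  rfl

/-- Only a misleading observation of a far arm makes `Choose` add a bad arm. -/
theorem Crossing.exists_hit_of_isBad (h : Crossing x ε) (he : 0 < e₀)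
    (hs : HitSpec x e₀ ε τ Hit Flip) (he2 : e₀ < ε)
    (hsel : ∀ t C, C.Nonempty → sel t C ∈ C) {k : Fin K}
    (hk : roundEntry τ (2 * e₀) m sel t = some k) (hb : IsBad x ε k) :
    ∃ i, ε ≤ |x ((exploreNode τ m t).arm i)| ∧
      Hit ((exploreNode τ m t).arm i) (m t ((exploreNode τ m t).arm i)) := by
  obtain ⟨i, hi, hc⟩ := roundEntry_eq_some hsel hk
  have hfar := h.far_of_isBad hb
  rcases hc with hc | ⟨rfl, hl, h1, h2⟩
  · refine ⟨i, by rwa [← hi], ?_⟩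
    rw [← hi]
    by_contra hn
    exact absurd (hs.far k _ hfar hn) (not_lt.mpr hc)
  · by_contra! hcon
    rw [arm_two] at hi
    rcases hb with hb | ⟨j, hj, hj'⟩
    · have h3 := (hs.sign k (m t k) (he2.trans_le hfar)
        (by rw [hi]; exact hcon 2 (by rwa [arm_two, ← hi]))).2 (fun h4 => by
          have := h.nonneg h4
          linarith [h.eps_pos])
      rw [← hi] at h2
      linarith
    · have h4 : j ≤ (exploreNode τ m t).left := by
        rw [hi, Fin.lt_def, hl] at hj
        rw [Fin.le_def]
        omega
      have h5 := h.high_of_le h4 hj'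
      have h6 : ε ≤ |x (exploreNode τ m t).left| := le_abs.mpr (Or.inl h5)
      have h7 := (hs.sign _ (m t (exploreNode τ m t).left) (he2.trans_le h6) (hcon 0 h6)).1
        (Or.inl (h.eps_pos.trans_le h5))
      linarith

/-- If no observation is misleading, a target contributes an entry. -/
theorem Crossing.exists_roundEntry_of_isTarget
    (hs : HitSpec x e₀ ε τ Hit Flip)
    (hn : ∀ i, ¬ Hit ((exploreNode τ m t).arm i) (m t ((exploreNode τ m t).arm i)))
    (ht : IsTarget x e₀ (explorePath τ m t)) :
    ∃ k, roundEntry τ (2 * e₀) m sel t = some k := by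
  by_cases hnear : ∃ i, |x ((exploreNode τ m t).arm i)| ≤ e₀
  · obtain ⟨i, hi⟩ := hnear
    exact exists_roundEntry (Or.inl (hs.near _ _ hi (hn i)))
  have ht' := ht.resolve_left hnear
  push Not at hnear
  have hL := (hs.sign _ _ (hnear 0) (hn 0)).2 ht'.2.1
  have hR := (hs.sign _ _ (hnear 2) (hn 2)).1 ht'.2.2
  rw [arm_zero] at hL
  rw [arm_two] at hR
  by_cases h1 : |m t (exploreNode τ m t).left - τ| ≤ 2 * e₀
  · exact exists_roundEntry (i := 0) (Or.inl h1)
  by_cases h2 : |m t (exploreNode τ m t).right - τ| ≤ 2 * e₀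
  · exact exists_roundEntry (i := 2) (Or.inl h2)
  rw [not_le, abs_of_neg (by linarith)] at h1
  rw [not_le, abs_of_pos (by linarith)] at h2
  exact exists_roundEntry (i := 2) (Or.inr ⟨rfl, ht'.1, by linarith, by linarith⟩)

theorem hitLevel_eq_zero_of {v : TreeNode K} {m : Fin K → ℝ}
    (hs : HitSpec x e₀ ε τ Hit Flip) (hn : ∀ i, ¬ Hit (v.arm i) (m (v.arm i))) :
    hitLevel Hit Flip v m = 0 := by
  classical
  unfold hitLevel
  rw [if_neg, if_neg]
  · rintro ⟨i, hi⟩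
    exact hn i hi
  · rintro (⟨i, _, _, hi, _⟩ | ⟨i, hi⟩)
    · exact hn i hi
    · exact hn i (hs.hit_of_flip _ _ hi).1

/-- The surplus minus the distance to the targets grows by one in a round, up to twice the
severity of the misleading observations. -/
theorem Crossing.gain_sub_targetDist (h : Crossing x ε) (he : 0 < e₀) (he2 : e₀ < ε)
    (hs : HitSpec x e₀ ε τ Hit Flip) (hsel : ∀ t C, C.Nonempty → sel t C ∈ C) (t : ℕ) :
    (1 : ℤ) - 2 * hitLevel Hit Flip (exploreNode τ m t) (m t) ≤
      gain x ε (roundEntry τ (2 * e₀) m sel t) -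
        targetDist x e₀ (explorePath τ m (t + 1)) + targetDist x e₀ (explorePath τ m t) := by
  classical
  have hp := validPath_explorePath (τ := τ) m t
  have hD := h.targetDist_exploreStep_le (τ := τ) (m := m t) he2 hp
  have hg := neg_one_le_gain (x := x) (ε := ε) (roundEntry τ (2 * e₀) m sel t)
  rw [explorePath_succ]
  by_cases h2 : (∃ i j, (exploreNode τ m t).arm i ≠ (exploreNode τ m t).arm j ∧
      Hit ((exploreNode τ m t).arm i) (m t ((exploreNode τ m t).arm i)) ∧
      Hit ((exploreNode τ m t).arm j) (m t ((exploreNode τ m t).arm j))) ∨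
      ∃ i, Flip ((exploreNode τ m t).arm i) (m t ((exploreNode τ m t).arm i))
  · have : hitLevel Hit Flip (exploreNode τ m t) (m t) = 2 := if_pos h2
    rw [this]
    push_cast
    omega
  by_cases h1 : ∃ i, Hit ((exploreNode τ m t).arm i) (m t ((exploreNode τ m t).arm i))
  · have : hitLevel Hit Flip (exploreNode τ m t) (m t) = 1 := by
      unfold hitLevel
      rw [if_neg h2, if_pos h1]
    rw [this]
    push_cast
    by_cases hg0 : 0 ≤ gain x ε (roundEntry τ (2 * e₀) m sel t)
    · omega
    obtain ⟨k, hk, hb⟩ : ∃ k, roundEntry τ (2 * e₀) m sel t = some k ∧ IsBad x ε k := by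
      rcases hr : roundEntry τ (2 * e₀) m sel t with _ | k
      · rw [hr] at hg0
        simp [gain] at hg0
      · refine ⟨k, rfl, ?_⟩
        by_contra hb
        rw [hr] at hg0
        simp [gain, hb] at hg0
    obtain ⟨i₀, hfar, hhit⟩ := h.exists_hit_of_isBad he hs he2 hsel hk hb
    push Not at h2
    have hsign : ∀ i, e₀ < |x ((exploreNode τ m t).arm i)| →
        SignRight x τ ((exploreNode τ m t).arm i) (m t ((exploreNode τ m t).arm i)) := by
      intro i hi
      by_cases hii : (exploreNode τ m t).arm i = (exploreNode τ m t).arm i₀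
      · rw [hii]
        exact hs.flip _ _ hfar (h2.2 i₀)
      · exact hs.sign _ _ hi fun hh => h2.1 i i₀ hii hh hhit
    have hD' : targetDist x e₀ (exploreStep τ (m t) (explorePath τ m t)) ≤
        targetDist x e₀ (explorePath τ m t) := by
      by_cases ht : IsTarget x e₀ (explorePath τ m t)
      · rw [targetDist_eq_zero (h.isTarget_exploreStep he2 hp ht hsign)]
        exact Nat.zero_le _
      · have := h.targetDist_exploreStep_lt hp ht hsign
        omega
    omega
  · push Not at h1
    rw [hitLevel_eq_zero_of hs h1]
    have hsign : ∀ i, e₀ < |x ((exploreNode τ m t).arm i)| →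
        SignRight x τ ((exploreNode τ m t).arm i) (m t ((exploreNode τ m t).arm i)) :=
      fun i hi => hs.sign _ _ hi (h1 i)
    have hnb : ∀ k, roundEntry τ (2 * e₀) m sel t = some k → ¬ IsBad x ε k := by
      intro k hk hb
      obtain ⟨i, -, hi⟩ := h.exists_hit_of_isBad he hs he2 hsel hk hb
      exact h1 i hi
    by_cases ht : IsTarget x e₀ (explorePath τ m t)
    · rw [targetDist_eq_zero (h.isTarget_exploreStep he2 hp ht hsign), targetDist_eq_zero ht]
      obtain ⟨k, hk⟩ := Crossing.exists_roundEntry_of_isTarget (sel := sel) hs h1 ht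
      simp [hk, gain, hnb k hk]
    · have h3 := h.targetDist_exploreStep_lt hp ht hsign
      have h4 : 0 ≤ gain x ε (roundEntry τ (2 * e₀) m sel t) := by
        rcases hr : roundEntry τ (2 * e₀) m sel t with _ | k
        · simp [gain]
        · simp [gain, hnb k hr]
      push_cast
      omega

theorem Crossing.sum_gain_ge (h : Crossing x ε) (he : 0 < e₀) (he2 : e₀ < ε)
    (hs : HitSpec x e₀ ε τ Hit Flip) (hsel : ∀ t C, C.Nonempty → sel t C ∈ C) (t : ℕ) :
    (t : ℤ) - 2 * (∑ s ∈ Finset.range t, hitLevel Hit Flip (exploreNode τ m s) (m s) : ℕ) +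
      targetDist x e₀ (explorePath τ m t) ≤
      ∑ s ∈ Finset.range t, gain x ε (roundEntry τ (2 * e₀) m sel s) +
        targetDist x e₀ ([] : List Bool) := by
  induction t with
  | zero => simp [explorePath]
  | succ t ih =>
    have := h.gain_sub_targetDist (m := m) he he2 hs hsel t
    rw [Finset.sum_range_succ, Finset.sum_range_succ]
    push_cast at this ih ⊢
    linarith

/-- What is known when the data-dependent parameter is not the minimal one. -/
theorem epsHat_ne (hne : epsHat τ e₀ m ≠ 2 * e₀) :
    2 * e₀ < epsHat τ e₀ m ∧ ∀ t < roundCount K,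
      ¬ ((exploreNode τ m t).IsLeaf ∧ m t (exploreNode τ m t).left ≤ τ ∧
        τ ≤ m t (exploreNode τ m t).right) ∧
      ∀ i, epsHat τ e₀ m ≤ |m t ((exploreNode τ m t).arm i) - τ| := by
  classical
  unfold epsHat at hne ⊢
  split_ifs at hne ⊢ with hc
  · exact absurd rfl hne
  have h1 : 2 * e₀ < ⨅ q : Fin (roundCount K) × Fin 3,
      |m q.1 ((exploreNode τ m q.1).arm q.2) - τ| := by
    by_contra hle
    exact hne (max_eq_left (not_lt.mp hle))
  rw [max_eq_right h1.le]
  refine ⟨h1, fun t ht => ⟨fun h2 => hc ⟨t, ht, h2⟩, fun i => ?_⟩⟩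
  exact ciInf_le (f := fun q : Fin (roundCount K) × Fin 3 =>
    |m q.1 ((exploreNode τ m q.1).arm q.2) - τ|) (Set.finite_range _).bddBelow ⟨⟨t, ht⟩, i⟩

/-- A correctly seen target that has no observation within `2 e₀` is a leaf seen crossing `τ`. -/
theorem Crossing.le_of_epsHat_ne (h : Crossing x ε) (he2 : e₀ < ε)
    (hs : HitSpec x e₀ ε τ Hit Flip) (hne : epsHat τ e₀ m ≠ 2 * e₀) :
    roundCount K ≤ Nat.clog 2 (K - 1) + 2 * ∑ s ∈ Finset.range (roundCount K),
      hitLevel Hit Flip (exploreNode τ m s) (m s) := by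
  classical
  obtain ⟨h1, h2⟩ := epsHat_ne hne
  suffices H : ∀ t ≤ roundCount K, t + targetDist x e₀ (explorePath τ m t) ≤
      targetDist x e₀ ([] : List Bool) + 2 * ∑ s ∈ Finset.range t,
        hitLevel Hit Flip (exploreNode τ m s) (m s) by
    have := H _ le_rfl
    have := h.targetDist_root_le (c := e₀)
    omega
  intro t
  induction t with
  | zero => intro _; simp [explorePath]
  | succ t ih =>
    intro ht
    specialize ih (by omega)
    obtain ⟨hleaf, hval⟩ := h2 t (by omega)
    have hp := validPath_explorePath (τ := τ) m t
    rw [Finset.sum_range_succ, explorePath_succ]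
    by_cases hn : ∀ i, ¬ Hit ((exploreNode τ m t).arm i) (m t ((exploreNode τ m t).arm i))
    · have hsign : ∀ i, e₀ < |x ((exploreNode τ m t).arm i)| →
          SignRight x τ ((exploreNode τ m t).arm i) (m t ((exploreNode τ m t).arm i)) :=
        fun i hi => hs.sign _ _ hi (hn i)
      by_cases htar : IsTarget x e₀ (explorePath τ m t)
      · exfalso
        by_cases hnear : ∃ i, |x ((exploreNode τ m t).arm i)| ≤ e₀
        · obtain ⟨i, hi⟩ := hnear
          linarith [hs.near _ _ hi (hn i), hval i]
        · have ht' := htar.resolve_left hnear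
          push Not at hnear
          exact hleaf ⟨ht'.1, ((hsign 0 (hnear 0)).2 ht'.2.1).le,
            ((hsign 2 (hnear 2)).1 ht'.2.2).le⟩
      · have := h.targetDist_exploreStep_lt hp htar hsign
        omega
    · have hD := h.targetDist_exploreStep_le (τ := τ) (m := m t) he2 hp
      have : 1 ≤ hitLevel Hit Flip (exploreNode τ m t) (m t) := by
        push Not at hn
        unfold hitLevel
        split_ifs
        · norm_num
        · norm_num
      omega

theorem exists_roundEntry_of_mem {k : Fin K} (hk : k ∈ chooseList τ e m sel) :
    ∃ t < roundCount K, roundEntry τ e m sel t = some k := by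
  rw [chooseList_eq, List.mem_filterMap] at hk
  obtain ⟨t, ht, h⟩ := hk
  exact ⟨t, List.mem_range.mp ht, h⟩

/-- A bad output needs many misleading observations. -/
theorem Crossing.le_of_isBad (h : Crossing x ε) (he : 0 < e₀) (he2 : e₀ < ε)
    (hs : HitSpec x e₀ ε τ Hit Flip) (hsel : ∀ t C, C.Nonempty → sel t C ∈ C) {k : Fin K}
    (hk : IsMTBOutput τ e₀ m sel k) (hb : IsBad x ε k) :
    roundCount K ≤ Nat.clog 2 (K - 1) + 2 * ∑ s ∈ Finset.range (roundCount K),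
      hitLevel Hit Flip (exploreNode τ m s) (m s) := by
  classical
  by_cases hne : epsHat τ e₀ m = 2 * e₀
  swap
  · exact h.le_of_epsHat_ne he2 hs hne
  unfold IsMTBOutput at hk
  rw [hne, chooseList_eq] at hk
  have h1 := h.countP_le_of_isMedian hk hb
  have h2 := countP_sub_countP_filterMap (x := x) (ε := ε) (roundEntry τ (2 * e₀) m sel)
    (roundCount K)
  have h3 := h.sum_gain_ge (m := m) he he2 hs hsel (roundCount K)
  have h4 := h.targetDist_root_le (c := e₀)
  omega

/-- A bad output with the minimal parameter needs a misleading observation of a far arm. -/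
theorem Crossing.exists_far_hit_of_isBad (h : Crossing x ε) (he : 0 < e₀) (he2 : e₀ < ε)
    (hs : HitSpec x e₀ ε τ Hit Flip) (hsel : ∀ t C, C.Nonempty → sel t C ∈ C) {k : Fin K}
    (hk : IsMTBOutput τ e₀ m sel k) (hb : IsBad x ε k) (heq : epsHat τ e₀ m = 2 * e₀) :
    ∃ t < roundCount K, ∃ i, ε ≤ |x ((exploreNode τ m t).arm i)| ∧
      Hit ((exploreNode τ m t).arm i) (m t ((exploreNode τ m t).arm i)) := by
  unfold IsMTBOutput at hk
  rw [heq] at hk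
  obtain ⟨t, ht, ht'⟩ := exists_roundEntry_of_mem hk.1
  exact ⟨t, ht, h.exists_hit_of_isBad he hs he2 hsel ht' hb⟩

/-- The observation `y` of arm `k` is off by at least `d` towards `τ`. -/
def Deviates (x : Fin K → ℝ) (τ d : ℝ) (k : Fin K) (y : ℝ) : Prop :=
  (IsPos x k → y - τ ≤ x k - d) ∧ (¬ IsPos x k → x k + d ≤ y - τ)

/-- A bad output with a large parameter, or with a large accuracy, needs an observation that is off
by half the accuracy. -/
theorem Crossing.exists_deviates_of_isBad (h : Crossing x ε) (he : 0 < e₀)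
    (hsel : ∀ t C, C.Nonempty → sel t C ∈ C) (hT : Nat.clog 2 (K - 1) < roundCount K) {k : Fin K}
    (hk : IsMTBOutput τ e₀ m sel k) (hb : IsBad x ε k)
    (hor : epsHat τ e₀ m ≠ 2 * e₀ ∨ 2 * e₀ ≤ ε / 2) :
    ∃ t < roundCount K, ∃ i, Deviates x τ (ε / 2) ((exploreNode τ m t).arm i)
      (m t ((exploreNode τ m t).arm i)) := by
  by_contra! hcon
  have hpos : ∀ t < roundCount K, ∀ i, IsPos x ((exploreNode τ m t).arm i) →
      x ((exploreNode τ m t).arm i) - ε / 2 < m t ((exploreNode τ m t).arm i) - τ := by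
    intro t ht i hi
    by_contra hle
    exact hcon t ht i ⟨fun _ => not_lt.mp hle, fun h' => absurd hi h'⟩
  have hneg : ∀ t < roundCount K, ∀ i, ¬ IsPos x ((exploreNode τ m t).arm i) →
      m t ((exploreNode τ m t).arm i) - τ < x ((exploreNode τ m t).arm i) + ε / 2 := by
    intro t ht i hi
    by_contra hle
    exact hcon t ht i ⟨fun h' => absurd h' hi, fun _ => not_lt.mp hle⟩
  have hε := h.eps_pos
  have hlow : ∀ {k : Fin K}, x k ≤ -ε → ¬ IsPos x k := fun h1 h2 => by
    linarith [h.nonneg h2]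
  have hhigh : ∀ {k : Fin K}, ε ≤ x k → IsPos x k := fun h1 => Or.inl (by linarith)
  obtain ⟨t, ht, hent⟩ := exists_roundEntry_of_mem hk.1
  obtain ⟨i, hi, hc⟩ := roundEntry_eq_some hsel hent
  by_cases hne : epsHat τ e₀ m = 2 * e₀
  · have h4 : 2 * e₀ ≤ ε / 2 := hor.resolve_left (not_not.mpr hne)
    rw [hne] at hc
    rcases hc with hc | ⟨rfl, hl, h1, h2⟩
    · rw [abs_le] at hc
      rcases hb with hb | ⟨j, hj, hj'⟩
      · have := hneg t ht i (by rw [← hi]; exact hlow hb)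
        rw [← hi] at this
        linarith
      · have hx := h.high_of_le hj.le hj'
        have := hpos t ht i (by rw [← hi]; exact hhigh hx)
        rw [← hi] at this
        linarith
    · rw [arm_two] at hi
      rcases hb with hb | ⟨j, hj, hj'⟩
      · have := hneg t ht 2 (by rw [arm_two, ← hi]; exact hlow hb)
        rw [arm_two, ← hi] at this
        rw [← hi] at h2
        linarith
      · have h5 : j ≤ (exploreNode τ m t).left := by
          rw [hi, Fin.lt_def, hl] at hj
          rw [Fin.le_def]
          omega
        have hx := h.high_of_le h5 hj'
        have := hpos t ht 0 (hhigh hx)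
        rw [arm_zero] at this
        linarith
  obtain ⟨h2e, hall⟩ := epsHat_ne hne
  have hbig : ε / 2 < epsHat τ e₀ m := by
    rcases hc with hc | ⟨rfl, hl, h1, h2⟩
    · rw [abs_le] at hc
      rcases hb with hb | ⟨j, hj, hj'⟩
      · have := hneg t ht i (by rw [← hi]; exact hlow hb)
        rw [← hi] at this
        linarith
      · have hx := h.high_of_le hj.le hj'
        have := hpos t ht i (by rw [← hi]; exact hhigh hx)
        rw [← hi] at this
        linarith
    · exact absurd ⟨hl, by linarith, by linarith⟩ (hall t ht).1
  have hsign : ∀ t < roundCount K, ∀ i, SignRight x τ ((exploreNode τ m t).arm i)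
      (m t ((exploreNode τ m t).arm i)) := by
    intro t ht i
    have h1 := (hall t ht).2 i
    constructor
    · intro h2
      have h3 := hpos t ht i h2
      have h4 := h.nonneg h2
      by_contra hle
      rw [abs_of_nonpos (by linarith)] at h1
      linarith
    · intro h2
      have h3 := hneg t ht i h2
      have h4 := nonpos_of_not_isPos h2
      by_contra hle
      rw [abs_of_nonneg (by linarith)] at h1
      linarith
  have H : ∀ t ≤ roundCount K, t + targetDist x (-1) (explorePath τ m t) ≤
      targetDist x (-1) ([] : List Bool) := by
    intro t
    induction t with
    | zero => intro _; simp [explorePath]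
    | succ t ih =>
      intro ht
      specialize ih (by omega)
      have hs := hsign t (by omega)
      have htar : ¬ IsTarget x (-1) (explorePath τ m t) := by
        rintro (⟨i, hi⟩ | ⟨hl, ho⟩)
        · linarith [abs_nonneg (x ((TreeNode.ofPath K (explorePath τ m t)).arm i))]
        · exact (hall t (by omega)).1 ⟨hl, ((hs 0).2 ho.1).le, ((hs 2).1 ho.2).le⟩
      have := h.targetDist_exploreStep_lt (validPath_explorePath m t) htar fun i _ => hs i
      rw [explorePath_succ]
      omega
  have h5 := H _ le_rfl
  have h6 := h.targetDist_root_le (c := -1)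
  omega

end Rounds

end MTB

end

noncomputable section

namespace MTB

open scoped ENNReal

/-- The sum over the ways to collect a total of `j` from the first `t` rounds, where a round gives
`0`, `1` or `2`, of the products of the weights `1`, `a s`, `b s` of what the rounds give. -/
def levelSum (a b : ℕ → ℝ≥0∞) : ℕ → ℕ → ℝ≥0∞
  | _, 0 => 1
  | 0, _ + 1 => 0
  | t + 1, 1 => levelSum a b t 1 + a t
  | t + 1, j + 2 => levelSum a b t (j + 2) + a t * levelSum a b t (j + 1) + b t * levelSum a b t j

section LevelSum

variable {a b : ℕ → ℝ≥0∞} {n : ℕ → ℕ} {t j : ℕ} {W : ℝ≥0∞}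

@[simp] theorem levelSum_zero_right : levelSum a b t 0 = 1 := by
  cases t <;> rfl

theorem levelSum_le_succ (t j : ℕ) : levelSum a b t j ≤ levelSum a b (t + 1) j := by
  match j with
  | 0 => simp
  | 1 => exact le_self_add
  | j + 2 =>
    simp only [levelSum]
    rw [add_assoc]
    exact le_self_add

theorem mul_levelSum_le_succ (t j : ℕ) :
    a t * levelSum a b t j ≤ levelSum a b (t + 1) (j + 1) := by
  match j with
  | 0 => simp [levelSum]
  | j + 1 =>
    simp only [levelSum]
    rw [add_assoc]
    exact le_self_add.trans le_add_self

theorem mul_levelSum_le_succ_two (t j : ℕ) :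
    b t * levelSum a b t j ≤ levelSum a b (t + 1) (j + 2) := by
  simp only [levelSum]
  exact le_add_self

theorem one_le_levelSum (hn : ∀ s, n s ≤ 2) (ha : ∀ s, 1 ≤ n s → 1 ≤ a s)
    (hb : ∀ s, n s = 2 → 1 ≤ b s) (t : ℕ) :
    ∀ j, j ≤ ∑ s ∈ Finset.range t, n s → 1 ≤ levelSum a b t j := by
  induction t with
  | zero =>
    intro j hj
    simp only [Finset.range_zero, Finset.sum_empty, Nat.le_zero] at hj
    simp [hj]
  | succ t ih =>
    intro j hj
    rw [Finset.sum_range_succ] at hj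
    by_cases h0 : j ≤ ∑ s ∈ Finset.range t, n s
    · exact (ih j h0).trans (levelSum_le_succ t j)
    by_cases h1 : j ≤ ∑ s ∈ Finset.range t, n s + 1
    · obtain ⟨i, rfl⟩ : ∃ i, j = i + 1 := ⟨j - 1, by omega⟩
      exact (one_le_mul (ha t (by omega)) (ih i (by omega))).trans (mul_levelSum_le_succ t i)
    · have := hn t
      obtain ⟨i, rfl⟩ : ∃ i, j = i + 2 := ⟨j - 2, by omega⟩
      exact (one_le_mul (hb t (by omega)) (ih i (by omega))).trans (mul_levelSum_le_succ_two t i)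

theorem le_levelSum (hn : ∀ s, n s ≤ 2) (ha : ∀ s, 1 ≤ n s → 1 ≤ a s)
    (hb : ∀ s, n s = 2 → 1 ≤ b s) {r : ℕ} (hr : 1 ≤ n r) (har : W ≤ a r)
    (hbr : n r = 2 → W ≤ b r) (t : ℕ) (hrt : r < t) :
    ∀ j, 1 ≤ j → j ≤ ∑ s ∈ Finset.range t, n s → W ≤ levelSum a b t j := by
  induction t with
  | zero => omega
  | succ t ih =>
    intro j hj1 hj
    rw [Finset.sum_range_succ] at hj
    have h2 := hn t
    rcases Nat.lt_succ_iff_lt_or_eq.mp hrt with hlt | rfl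
    · specialize ih hlt
      have hpos : 1 ≤ ∑ s ∈ Finset.range t, n s :=
        hr.trans (Finset.single_le_sum (f := n) (fun _ _ => Nat.zero_le _)
          (Finset.mem_range.mpr hlt))
      by_cases h0 : j ≤ ∑ s ∈ Finset.range t, n s
      · exact (ih j hj1 h0).trans (levelSum_le_succ t j)
      by_cases h1 : j ≤ ∑ s ∈ Finset.range t, n s + 1
      · obtain ⟨i, rfl⟩ : ∃ i, j = i + 1 := ⟨j - 1, by omega⟩
        exact ((ih i (by omega) (by omega)).trans (le_mul_of_one_le_left' (ha t (by omega)))).trans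
          (mul_levelSum_le_succ t i)
      · obtain ⟨i, rfl⟩ : ∃ i, j = i + 2 := ⟨j - 2, by omega⟩
        exact ((ih i (by omega) (by omega)).trans (le_mul_of_one_le_left' (hb t (by omega)))).trans
          (mul_levelSum_le_succ_two t i)
    · by_cases h1 : j ≤ ∑ s ∈ Finset.range r, n s + 1
      · obtain ⟨i, rfl⟩ : ∃ i, j = i + 1 := ⟨j - 1, by omega⟩
        exact (har.trans (le_mul_of_one_le_right' (one_le_levelSum hn ha hb r i (by omega)))).trans
          (mul_levelSum_le_succ r i)
      · obtain ⟨i, rfl⟩ : ∃ i, j = i + 2 := ⟨j - 2, by omega⟩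
        exact ((hbr (by omega)).trans (le_mul_of_one_le_right'
          (one_le_levelSum hn ha hb r i (by omega)))).trans (mul_levelSum_le_succ_two r i)

end LevelSum

theorem measurable_comp_pi {Ω : Type*} {_ : MeasurableSpace Ω} {K : ℕ} {y : Fin K → Ω → ℝ}
    (hy : ∀ k, Measurable (y k)) {f : (Fin K → ℝ) → ℝ≥0∞} (hf : Measurable f) :
    Measurable fun ω => f (fun k => y k ω) :=
  hf.comp (measurable_pi_lambda _ hy)

section Adapted

variable {Ω : Type*} {K : ℕ} [NeZero K] {τ : ℝ} {m : ℕ → Fin K → Ω → ℝ}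

theorem measurableSet_exploreStep {_ : MeasurableSpace Ω} {t : ℕ}
    (hm : ∀ k, Measurable (m t k)) (p q : List Bool) :
    MeasurableSet {ω | exploreStep τ (fun k => m t k ω) p = q} := by
  classical
  let _ : MeasurableSpace (List Bool) := ⊤
  have h1 : ∀ k, MeasurableSet {ω | m t k ω ≤ τ} := fun k => measurableSet_le (hm k) measurable_const
  have h2 : ∀ k, MeasurableSet {ω | τ ≤ m t k ω} := fun k => measurableSet_le measurable_const (hm k)
  have h : Measurable fun ω => exploreStep τ (fun k => m t k ω) p := by
    unfold exploreStep
    dsimp only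
    refine Measurable.ite ((h1 _).inter (h2 _)).compl measurable_const ?_
    refine Measurable.ite (MeasurableSet.const _) measurable_const ?_
    exact Measurable.ite ((h1 _).inter (h2 _)) measurable_const measurable_const
  exact h (MeasurableSpace.measurableSet_top (s := {q}))

theorem measurableSet_explorePath {_ : MeasurableSpace Ω} (t : ℕ) :
    (∀ s < t, ∀ k, Measurable (m s k)) → ∀ q : List Bool,
    MeasurableSet {ω | explorePath τ (fun s k => m s k ω) t = q} := by
  induction t with
  | zero => exact fun _ q => MeasurableSet.const ([] = q)
  | succ t ih =>
    intro hm q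
    have : {ω | explorePath τ (fun s k => m s k ω) (t + 1) = q} =
        ⋃ p : List Bool, {ω | explorePath τ (fun s k => m s k ω) t = p} ∩
          {ω | exploreStep τ (fun k => m t k ω) p = q} := by
      ext ω
      simp [explorePath]
    rw [this]
    exact MeasurableSet.iUnion fun p => (ih (fun s hs => hm s (by omega)) p).inter
      (measurableSet_exploreStep (hm t (by omega)) p q)

theorem eq_tsum_indicator {β : Type*} (f : Ω → β) (g : β → Ω → ℝ≥0∞) (ω : Ω) :
    g (f ω) ω = ∑' p, {ω | f ω = p}.indicator (g p) ω := by
  classical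
  rw [tsum_eq_single (f ω)]
  · simp
  · intro p hp
    exact Set.indicator_of_notMem (fun h => hp h.symm) _

theorem measurable_comp_explorePath {_ : MeasurableSpace Ω} {t : ℕ}
    (hm : ∀ s < t + 1, ∀ k, Measurable (m s k)) {A : List Bool → (Fin K → ℝ) → ℝ≥0∞}
    (hA : ∀ p, Measurable (A p)) :
    Measurable fun ω => A (explorePath τ (fun s k => m s k ω) t) (fun k => m t k ω) := by
  have : (fun ω => A (explorePath τ (fun s k => m s k ω) t) (fun k => m t k ω)) = fun ω =>
      ∑' p, {ω | explorePath τ (fun s k => m s k ω) t = p}.indicator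
        (fun ω => A p (fun k => m t k ω)) ω :=
    funext fun ω => eq_tsum_indicator (fun ω => explorePath τ (fun s k => m s k ω) t)
      (fun p ω => A p (fun k => m t k ω)) ω
  rw [this]
  refine Measurable.tsum fun p => ?_
  exact (measurable_comp_pi (hm t (by omega)) (hA p)).indicator
    (measurableSet_explorePath t (fun s hs => hm s (by omega)) p)

theorem measurable_levelSum {_ : MeasurableSpace Ω} {a b : ℕ → Ω → ℝ≥0∞} (t : ℕ) :
    (∀ s < t, Measurable (a s)) → (∀ s < t, Measurable (b s)) → ∀ j,
    Measurable fun ω => levelSum (fun s => a s ω) (fun s => b s ω) t j := by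
  induction t with
  | zero =>
    intro _ _ j
    cases j <;> exact measurable_const
  | succ t ih =>
    intro ha hb j
    specialize ih (fun s hs => ha s (by omega)) (fun s hs => hb s (by omega))
    match j with
    | 0 => exact measurable_const
    | 1 => exact (ih 1).add (ha t (by omega))
    | j + 2 =>
      exact ((ih (j + 2)).add ((ha t (by omega)).mul (ih (j + 1)))).add
        ((hb t (by omega)).mul (ih j))

/-- Conditioning on the past: the weight of the present round has expectation at most `g`,
whatever the current node. -/
theorem lintegral_mul_explorePath_le {past pres mΩ : MeasurableSpace Ω} {P : Measure Ω}
    (hpast : past ≤ mΩ) (hpres : pres ≤ mΩ) (hind : Indep past pres P) {t : ℕ}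
    (hm : ∀ s < t, ∀ k, Measurable[past] (m s k)) (hmt : ∀ k, Measurable[pres] (m t k))
    {A : List Bool → (Fin K → ℝ) → ℝ≥0∞} (hA : ∀ p, Measurable (A p)) {g : ℝ≥0∞}
    (hg : ∀ p, ∫⁻ ω, A p (fun k => m t k ω) ∂P ≤ g) {Y : Ω → ℝ≥0∞} (hY : Measurable[past] Y) :
    ∫⁻ ω, A (explorePath τ (fun s k => m s k ω) t) (fun k => m t k ω) * Y ω ∂P ≤
      g * ∫⁻ ω, Y ω ∂P := by
  have hset : ∀ p, MeasurableSet[past] {ω | explorePath τ (fun s k => m s k ω) t = p} :=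
    fun p => measurableSet_explorePath t hm p
  have hYp : ∀ p, Measurable[past] ({ω | explorePath τ (fun s k => m s k ω) t = p}.indicator Y) :=
    fun p => hY.indicator (hset p)
  have hAp : ∀ p, Measurable[pres] fun ω => A p (fun k => m t k ω) :=
    fun p => measurable_comp_pi hmt (hA p)
  have e1 : ∀ ω, A (explorePath τ (fun s k => m s k ω) t) (fun k => m t k ω) * Y ω =
      ∑' p, {ω | explorePath τ (fun s k => m s k ω) t = p}.indicator Y ω *
        A p (fun k => m t k ω) := by
    intro ω
    have := eq_tsum_indicator (fun ω => explorePath τ (fun s k => m s k ω) t)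
      (fun p ω => Y ω * A p (fun k => m t k ω)) ω
    rw [mul_comm]
    refine this.trans (tsum_congr fun p => ?_)
    by_cases h : explorePath τ (fun s k => m s k ω) t = p <;> simp [Set.indicator, h]
  have e2 : ∀ ω, Y ω = ∑' p, {ω | explorePath τ (fun s k => m s k ω) t = p}.indicator Y ω :=
    fun ω => eq_tsum_indicator (fun ω => explorePath τ (fun s k => m s k ω) t) (fun _ => Y) ω
  calc ∫⁻ ω, A (explorePath τ (fun s k => m s k ω) t) (fun k => m t k ω) * Y ω ∂P
      = ∑' p, ∫⁻ ω, {ω | explorePath τ (fun s k => m s k ω) t = p}.indicator Y ω *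
          A p (fun k => m t k ω) ∂P := by
        rw [lintegral_congr e1, lintegral_tsum]
        intro p
        exact (((hYp p).mono hpast le_rfl).mul ((hAp p).mono hpres le_rfl)).aemeasurable
    _ = ∑' p, (∫⁻ ω, {ω | explorePath τ (fun s k => m s k ω) t = p}.indicator Y ω ∂P) *
          ∫⁻ ω, A p (fun k => m t k ω) ∂P := by
        refine tsum_congr fun p => ?_
        exact lintegral_mul_eq_lintegral_mul_lintegral_of_independent_measurableSpace
          hpast hpres hind (hYp p) (hAp p)
    _ ≤ ∑' p, (∫⁻ ω, {ω | explorePath τ (fun s k => m s k ω) t = p}.indicator Y ω ∂P) * g :=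
        ENNReal.tsum_le_tsum fun p => by gcongr; exact hg p
    _ = g * ∫⁻ ω, Y ω ∂P := by
        rw [ENNReal.tsum_mul_right, mul_comm, ← lintegral_tsum, ← lintegral_congr e2]
        intro p
        exact ((hYp p).mono hpast le_rfl).aemeasurable

theorem choose_add_three_ge (n j : ℕ) : n.choose (j + 2) + 3 * n.choose (j + 1) +
    3 * n.choose j ≤ (n + 3).choose (j + 2) := by
  have h1 := Nat.choose_succ_succ' (n + 2) (j + 1)
  have h2 := Nat.choose_succ_succ' (n + 1) j
  have h3 := Nat.choose_succ_succ' (n + 1) (j + 1)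
  have h4 := Nat.choose_succ_succ' n j
  have h5 := Nat.choose_succ_succ' n (j + 1)
  have h6 := Nat.choose_le_succ n j
  simp only [add_assoc, Nat.reduceAdd, Nat.succ_eq_add_one] at *
  omega

theorem lintegral_levelSum_le {mΩ : MeasurableSpace Ω} {P : Measure Ω} [IsProbabilityMeasure P]
    {past pres : ℕ → MeasurableSpace Ω}
    (hpast : ∀ t, past t ≤ mΩ) (hpres : ∀ t, pres t ≤ mΩ) (hind : ∀ t, Indep (past t) (pres t) P)
    (hm : ∀ t, ∀ s < t, ∀ k, Measurable[past t] (m s k)) (hmt : ∀ t k, Measurable[pres t] (m t k))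
    {A B : List Bool → (Fin K → ℝ) → ℝ≥0∞} (hA : ∀ p, Measurable (A p))
    (hB : ∀ p, Measurable (B p)) {q : ℝ≥0∞}
    (hqA : ∀ t p, ∫⁻ ω, A p (fun k => m t k ω) ∂P ≤ 3 * q)
    (hqB : ∀ t p, ∫⁻ ω, B p (fun k => m t k ω) ∂P ≤ 3 * q ^ 2) (t : ℕ) :
    ∀ j, ∫⁻ ω, levelSum
        (fun s => A (explorePath τ (fun s k => m s k ω) s) (fun k => m s k ω))
        (fun s => B (explorePath τ (fun s k => m s k ω) s) (fun k => m s k ω)) t j ∂P ≤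
      ((3 * t).choose j : ℝ≥0∞) * q ^ j := by
  induction t with
  | zero =>
    intro j
    cases j <;> simp [levelSum]
  | succ t ih =>
    have hMA : ∀ r, ∀ s < r, Measurable[past r] fun ω =>
        A (explorePath τ (fun s k => m s k ω) s) (fun k => m s k ω) := fun r s hs =>
      measurable_comp_explorePath (fun i hi => hm r i (by omega)) hA
    have hMB : ∀ r, ∀ s < r, Measurable[past r] fun ω =>
        B (explorePath τ (fun s k => m s k ω) s) (fun k => m s k ω) := fun r s hs =>
      measurable_comp_explorePath (fun i hi => hm r i (by omega)) hB
    have hL : ∀ r j, Measurable[past r] fun ω => levelSum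
        (fun s => A (explorePath τ (fun s k => m s k ω) s) (fun k => m s k ω))
        (fun s => B (explorePath τ (fun s k => m s k ω) s) (fun k => m s k ω)) r j := fun r j =>
      measurable_levelSum r (hMA r) (hMB r) j
    have stepA := fun j => lintegral_mul_explorePath_le (τ := τ) (hpast t) (hpres t) (hind t)
      (hm t) (hmt t) hA (hqA t) (hL t j)
    have stepB := fun j => lintegral_mul_explorePath_le (τ := τ) (hpast t) (hpres t) (hind t)
      (hm t) (hmt t) hB (hqB t) (hL t j)
    intro j
    match j with
    | 0 => simp [levelSum]
    | 1 =>
      simp only [levelSum]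
      rw [lintegral_add_left ((hL t 1).mono (hpast t) le_rfl)]
      have h0 := stepA 0
      simp only [levelSum_zero_right, mul_one, lintegral_one, measure_univ] at h0
      refine (add_le_add (ih 1) h0).trans (le_of_eq ?_)
      simp only [Nat.choose_one_right]
      push_cast
      ring
    | j + 2 =>
      simp only [levelSum]
      have m1 := (hL t (j + 2)).mono (hpast t) le_rfl
      have m2 := ((hMA (t + 1) t (by omega)).mono (hpast (t + 1)) le_rfl).fun_mul
        ((hL t (j + 1)).mono (hpast t) le_rfl)
      rw [lintegral_add_left (m1.fun_add m2), lintegral_add_left m1]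
      refine (add_le_add (add_le_add (ih (j + 2)) (stepA (j + 1))) (stepB j)).trans ?_
      refine (add_le_add (add_le_add le_rfl (mul_le_mul_right (ih (j + 1)) (3 * q)))
        (mul_le_mul_right (ih j) (3 * q ^ 2))).trans ?_
      have hc : ((3 * t).choose (j + 2) : ℝ≥0∞) + 3 * (3 * t).choose (j + 1) +
          3 * (3 * t).choose j ≤ ((3 * (t + 1)).choose (j + 2) : ℕ) := by
        exact_mod_cast choose_add_three_ge (3 * t) j
      calc _ = (((3 * t).choose (j + 2) : ℝ≥0∞) + 3 * (3 * t).choose (j + 1) +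
          3 * (3 * t).choose j) * q ^ (j + 2) := by ring
        _ ≤ _ := by gcongr

end Adapted

end MTB

end

noncomputable section

namespace MTB

open scoped ENNReal

section Samples

variable {Ω : Type*} {mΩ : MeasurableSpace Ω} {P : Measure Ω} {K : ℕ}
  {X : ℕ → Fin K → ℕ → Ω → ℝ}

/-- The information in the samples with index in `S`. -/
abbrev sampleInfo (X : ℕ → Fin K → ℕ → Ω → ℝ) (S : Set (ℕ × Fin K × ℕ)) : MeasurableSpace Ω :=
  ⨆ q ∈ S, MeasurableSpace.comap (X q.1 q.2.1 q.2.2) inferInstance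

/-- The empirical mean of arm `k` in round `t` as a random variable. -/
def meanVar (X : ℕ → Fin K → ℕ → Ω → ℝ) (n t : ℕ) (k : Fin K) (ω : Ω) : ℝ :=
  empiricalMean n (fun t k j => X t k j ω) t k

theorem sampleInfo_le (hX : ∀ t k j, Measurable (X t k j)) (S : Set (ℕ × Fin K × ℕ)) :
    sampleInfo X S ≤ mΩ :=
  iSup₂_le fun q _ => (hX q.1 q.2.1 q.2.2).comap_le

theorem indep_sampleInfo (hX : ∀ t k j, Measurable (X t k j))
    (hindep : iIndepFun (fun q : ℕ × Fin K × ℕ => X q.1 q.2.1 q.2.2) P)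
    {S S' : Set (ℕ × Fin K × ℕ)} (hS : Disjoint S S') :
    Indep (sampleInfo X S) (sampleInfo X S') P :=
  indep_iSup_of_disjoint
    (m := fun q : ℕ × Fin K × ℕ => MeasurableSpace.comap (X q.1 q.2.1 q.2.2) inferInstance)
    (fun q => (hX q.1 q.2.1 q.2.2).comap_le) hindep.iIndep hS

theorem measurable_meanVar {S : Set (ℕ × Fin K × ℕ)} {n t : ℕ} {k : Fin K}
    (hS : ∀ j, (t, k, j) ∈ S) : Measurable[sampleInfo X S] (meanVar X n t k) := by
  have h : ∀ j, Measurable[sampleInfo X S] (X t k j) := fun j =>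
    (comap_measurable (X t k j)).mono
      (le_iSup₂_of_le (f := fun (q : ℕ × Fin K × ℕ) (_ : q ∈ S) =>
        MeasurableSpace.comap (X q.1 q.2.1 q.2.2) inferInstance) (t, k, j) (hS j) le_rfl) le_rfl
  unfold meanVar empiricalMean
  exact (Finset.measurable_fun_sum _ fun j _ => h j).div_const _

theorem measurable_meanVar' (hX : ∀ t k j, Measurable (X t k j)) (n t : ℕ) (k : Fin K) :
    Measurable (meanVar X n t k) :=
  (measurable_meanVar (S := Set.univ) fun _ => Set.mem_univ _).mono (sampleInfo_le hX _) le_rfl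

theorem hasSubgaussianMGF_sample [IsProbabilityMeasure P] {ν : Fin K → Measure ℝ} {σ : ℝ}
    (hsub : ∀ k, IsSubGaussian σ (ν k)) (hX : ∀ t k j, Measurable (X t k j))
    (hlaw : ∀ t k j, P.map (X t k j) = ν k) (t : ℕ) (k : Fin K) (j : ℕ) :
    HasSubgaussianMGF (fun ω => X t k j ω - armMean ν k) (Real.toNNReal (σ ^ 2)) P := by
  have h := hsub k
  unfold IsSubGaussian at h
  rw [← hlaw t k j] at h
  have h2 := HasSubgaussianMGF.of_map (hX t k j).aemeasurable h
  unfold armMean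
  rw [← hlaw t k j]
  exact h2

theorem iIndepFun_sample (hindep : iIndepFun (fun q : ℕ × Fin K × ℕ => X q.1 q.2.1 q.2.2) P)
    (t : ℕ) (k : Fin K) (c : ℝ) : iIndepFun (fun j ω => X t k j ω - c) P := by
  have h1 : Function.Injective fun j : ℕ => (t, k, j) := fun a b hab => by simpa using hab
  exact (hindep.precomp h1).comp (fun _ y => y - c) fun _ => measurable_id.sub_const c

theorem measure_meanVar_ge_le [IsProbabilityMeasure P] {ν : Fin K → Measure ℝ} {σ : ℝ}
    (hσ : 0 < σ) (hsub : ∀ k, IsSubGaussian σ (ν k)) (hX : ∀ t k j, Measurable (X t k j))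
    (hlaw : ∀ t k j, P.map (X t k j) = ν k)
    (hindep : iIndepFun (fun q : ℕ × Fin K × ℕ => X q.1 q.2.1 q.2.2) P) {n : ℕ} (hn : 1 ≤ n)
    {d : ℝ} (hd : 0 ≤ d) (t : ℕ) (k : Fin K) :
    P {ω | armMean ν k + d ≤ meanVar X n t k ω} ≤
      ENNReal.ofReal (Real.exp (-(n * d ^ 2 / (2 * σ ^ 2)))) := by
  have hn0 : (0 : ℝ) < n := by exact_mod_cast hn
  have h := HasSubgaussianMGF.measure_sum_range_ge_le_of_iIndepFun (n := n)
    (iIndepFun_sample hindep t k (armMean ν k))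
    (fun j _ => hasSubgaussianMGF_sample hsub hX hlaw t k j) (mul_nonneg hn0.le hd)
  replace h := (ENNReal.ofReal_toReal (measure_ne_top _ _)).symm.le.trans
    (ENNReal.ofReal_le_ofReal h)
  refine le_trans (measure_mono fun ω hω => ?_) (h.trans (le_of_eq ?_))
  · simp only [Set.mem_ofPred_eq, meanVar, empiricalMean] at hω ⊢
    rw [le_div_iff₀ hn0] at hω
    rw [Finset.sum_sub_distrib, Finset.sum_const, Finset.card_range, nsmul_eq_mul]
    linarith
  · congr 2
    rw [Real.coe_toNNReal _ (by positivity)]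
    field_simp

theorem measure_meanVar_le_le [IsProbabilityMeasure P] {ν : Fin K → Measure ℝ} {σ : ℝ}
    (hσ : 0 < σ) (hsub : ∀ k, IsSubGaussian σ (ν k)) (hX : ∀ t k j, Measurable (X t k j))
    (hlaw : ∀ t k j, P.map (X t k j) = ν k)
    (hindep : iIndepFun (fun q : ℕ × Fin K × ℕ => X q.1 q.2.1 q.2.2) P) {n : ℕ} (hn : 1 ≤ n)
    {d : ℝ} (hd : 0 ≤ d) (t : ℕ) (k : Fin K) :
    P {ω | meanVar X n t k ω ≤ armMean ν k - d} ≤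
      ENNReal.ofReal (Real.exp (-(n * d ^ 2 / (2 * σ ^ 2)))) := by
  have hn0 : (0 : ℝ) < n := by exact_mod_cast hn
  have hind : iIndepFun (fun j ω => -(X t k j ω - armMean ν k)) P :=
    (iIndepFun_sample hindep t k (armMean ν k)).comp (fun _ y => -y) fun _ => measurable_neg
  have h := HasSubgaussianMGF.measure_sum_range_ge_le_of_iIndepFun (n := n) hind
    (fun j _ => (hasSubgaussianMGF_sample hsub hX hlaw t k j).neg) (mul_nonneg hn0.le hd)
  replace h := (ENNReal.ofReal_toReal (measure_ne_top _ _)).symm.le.trans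
    (ENNReal.ofReal_le_ofReal h)
  refine le_trans (measure_mono fun ω hω => ?_) (h.trans (le_of_eq ?_))
  · simp only [Set.mem_ofPred_eq, meanVar, empiricalMean] at hω ⊢
    rw [div_le_iff₀ hn0] at hω
    rw [Finset.sum_neg_distrib, Finset.sum_sub_distrib, Finset.sum_const, Finset.card_range,
      nsmul_eq_mul]
    linarith
  · congr 2
    rw [Real.coe_toNNReal _ (by positivity)]
    field_simp

theorem measure_deviates_le [IsProbabilityMeasure P] [NeZero K] {ν : Fin K → Measure ℝ} {σ τ : ℝ}
    (hσ : 0 < σ) (hsub : ∀ k, IsSubGaussian σ (ν k)) (hX : ∀ t k j, Measurable (X t k j))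
    (hlaw : ∀ t k j, P.map (X t k j) = ν k)
    (hindep : iIndepFun (fun q : ℕ × Fin K × ℕ => X q.1 q.2.1 q.2.2) P) {n : ℕ} (hn : 1 ≤ n)
    {d : ℝ} (hd : 0 ≤ d) (t : ℕ) (k : Fin K) :
    P {ω | Deviates (fun k => armMean ν k - τ) τ d k (meanVar X n t k ω)} ≤
      ENNReal.ofReal (Real.exp (-(n * d ^ 2 / (2 * σ ^ 2)))) := by
  by_cases hk : IsPos (fun k => armMean ν k - τ) k
  · refine le_trans (measure_mono fun ω hω => ?_)
      (measure_meanVar_le_le hσ hsub hX hlaw hindep hn hd t k)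
    have := hω.1 hk
    simp only [Set.mem_ofPred_eq]
    linarith
  · refine le_trans (measure_mono fun ω hω => ?_)
      (measure_meanVar_ge_le hσ hsub hX hlaw hindep hn hd t k)
    have := hω.2 hk
    simp only [Set.mem_ofPred_eq]
    linarith

end Samples

section Weights

variable {K : ℕ} {Hit Flip : Fin K → ℝ → Prop} {w : Fin K → ℝ≥0∞}

/-- The total weight of the misleading observations at the arms of `v`. -/
def hitWeight (Hit : Fin K → ℝ → Prop) (w : Fin K → ℝ≥0∞) (v : TreeNode K) (y : Fin K → ℝ) :
    ℝ≥0∞ :=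
  ∑ i, w (v.arm i) * {z | Hit (v.arm i) z}.indicator 1 (y (v.arm i))

/-- The weight of a pair of misleading observations of different arms. -/
def pairWeight (Hit : Fin K → ℝ → Prop) (w : Fin K → ℝ≥0∞) (k l : Fin K) (y : Fin K → ℝ) :
    ℝ≥0∞ :=
  if k = l then 0 else
    (w k * {z | Hit k z}.indicator 1 (y k)) * (w l * {z | Hit l z}.indicator 1 (y l))

/-- The total weight of the pairs of misleading observations, and of the flips, at the arms of
`v`. -/
def doubleWeight (Hit Flip : Fin K → ℝ → Prop) (w : Fin K → ℝ≥0∞) (v : TreeNode K)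
    (y : Fin K → ℝ) : ℝ≥0∞ :=
  pairWeight Hit w (v.arm 0) (v.arm 1) y + pairWeight Hit w (v.arm 0) (v.arm 2) y +
    pairWeight Hit w (v.arm 1) (v.arm 2) y + hitWeight Flip w v y

theorem pairWeight_comm (k l : Fin K) (y : Fin K → ℝ) :
    pairWeight Hit w k l y = pairWeight Hit w l k y := by
  unfold pairWeight
  by_cases h : k = l
  · rw [if_pos h, if_pos h.symm]
  · rw [if_neg h, if_neg (Ne.symm h), mul_comm]

theorem le_hitWeight {v : TreeNode K} {y : Fin K → ℝ} {i : Fin 3}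
    (hi : Hit (v.arm i) (y (v.arm i))) : w (v.arm i) ≤ hitWeight Hit w v y := by
  have h : w (v.arm i) = w (v.arm i) * {z | Hit (v.arm i) z}.indicator 1 (y (v.arm i)) := by
    rw [Set.indicator_of_mem (by exact hi)]
    simp
  rw [h]
  exact Finset.single_le_sum
    (f := fun i => w (v.arm i) * {z | Hit (v.arm i) z}.indicator 1 (y (v.arm i)))
    (fun _ _ => zero_le) (Finset.mem_univ i)

theorem le_pairWeight (hw : ∀ k, 1 ≤ w k) {k l : Fin K} {y : Fin K → ℝ} (hkl : k ≠ l)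
    (hk : Hit k (y k)) (hl : Hit l (y l)) : w k ≤ pairWeight Hit w k l y := by
  unfold pairWeight
  rw [if_neg hkl, Set.indicator_of_mem (by exact hk), Set.indicator_of_mem (by exact hl)]
  simpa using le_mul_of_one_le_right' (hw l)

theorem pairWeight_le_doubleWeight {v : TreeNode K} {y : Fin K → ℝ} (i j : Fin 3) :
    pairWeight Hit w (v.arm i) (v.arm j) y ≤ doubleWeight Hit Flip w v y := by
  have h0 : ∀ k, pairWeight Hit w k k y = 0 := fun k => if_pos rfl
  have h01 : pairWeight Hit w (v.arm 0) (v.arm 1) y ≤ doubleWeight Hit Flip w v y := by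
    unfold doubleWeight
    rw [add_assoc, add_assoc]
    exact le_self_add
  have h02 : pairWeight Hit w (v.arm 0) (v.arm 2) y ≤ doubleWeight Hit Flip w v y := by
    unfold doubleWeight
    rw [add_assoc, add_assoc]
    exact le_self_add.trans le_add_self
  have h12 : pairWeight Hit w (v.arm 1) (v.arm 2) y ≤ doubleWeight Hit Flip w v y := by
    unfold doubleWeight
    exact le_add_self.trans le_self_add
  fin_cases i <;> fin_cases j
  · exact (h0 _).trans_le zero_le
  · exact h01
  · exact h02
  · exact (pairWeight_comm _ _ _).trans_le h01
  · exact (h0 _).trans_le zero_le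
  · exact h12
  · exact (pairWeight_comm _ _ _).trans_le h02
  · exact (pairWeight_comm _ _ _).trans_le h12
  · exact (h0 _).trans_le zero_le

theorem le_doubleWeight_of_flip {v : TreeNode K} {y : Fin K → ℝ} {i : Fin 3}
    (hi : Flip (v.arm i) (y (v.arm i))) : w (v.arm i) ≤ doubleWeight Hit Flip w v y :=
  (le_hitWeight hi).trans le_add_self

theorem exists_hit_of_one_le_hitLevel (hf : ∀ k z, Flip k z → Hit k z) {v : TreeNode K}
    {y : Fin K → ℝ} (h : 1 ≤ hitLevel Hit Flip v y) : ∃ i, Hit (v.arm i) (y (v.arm i)) := by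
  classical
  unfold hitLevel at h
  split_ifs at h with h1 h2
  · rcases h1 with ⟨i, _, _, hi, _⟩ | ⟨i, hi⟩
    · exact ⟨i, hi⟩
    · exact ⟨i, hf _ _ hi⟩
  · exact h2
  · omega

theorem one_le_hitLevel {v : TreeNode K} {y : Fin K → ℝ} {i : Fin 3}
    (hi : Hit (v.arm i) (y (v.arm i))) : 1 ≤ hitLevel Hit Flip v y := by
  classical
  unfold hitLevel
  split_ifs with h1 h2
  · norm_num
  · norm_num
  · exact absurd ⟨i, hi⟩ h2

theorem le_doubleWeight_of_hitLevel (hw : ∀ k, 1 ≤ w k) {W : ℝ≥0∞}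
    (hW : ∀ k z, Flip k z → W ≤ w k) {v : TreeNode K} {y : Fin K → ℝ} {i : Fin 3}
    (hi : Hit (v.arm i) (y (v.arm i))) (hWi : W ≤ w (v.arm i))
    (h : hitLevel Hit Flip v y = 2) : W ≤ doubleWeight Hit Flip w v y := by
  classical
  unfold hitLevel at h
  split_ifs at h with h1 h2
  · rcases h1 with ⟨j, l, hjl, hj, hl⟩ | ⟨j, hj⟩
    · by_cases hij : v.arm i = v.arm j
      · rw [← hij] at hjl
        exact (hWi.trans (le_pairWeight hw hjl hi hl)).trans (pairWeight_le_doubleWeight i l)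
      · exact (hWi.trans (le_pairWeight hw hij hi hj)).trans (pairWeight_le_doubleWeight i j)
    · exact (hW _ _ hj).trans (le_doubleWeight_of_flip hj)
  · omega

theorem measurable_indicator_apply {H : Set ℝ} (hH : MeasurableSet H) (k : Fin K) :
    Measurable fun y : Fin K → ℝ => (H.indicator 1 (y k) : ℝ≥0∞) :=
  ((measurable_const (a := (1 : ℝ≥0∞))).indicator hH).comp (measurable_pi_apply k)

theorem measurable_hitWeight (hH : ∀ k, MeasurableSet {z | Hit k z}) (v : TreeNode K) :
    Measurable (hitWeight Hit w v) :=
  Finset.measurable_fun_sum _ fun _ _ => (measurable_indicator_apply (hH _) _).const_mul _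

theorem measurable_pairWeight (hH : ∀ k, MeasurableSet {z | Hit k z}) (k l : Fin K) :
    Measurable (pairWeight Hit w k l) := by
  unfold pairWeight
  by_cases h : k = l
  · simp only [if_pos h]
    exact measurable_const
  · simp only [if_neg h]
    exact ((measurable_indicator_apply (hH _) _).const_mul _).mul
      ((measurable_indicator_apply (hH _) _).const_mul _)

theorem measurable_doubleWeight (hH : ∀ k, MeasurableSet {z | Hit k z})
    (hF : ∀ k, MeasurableSet {z | Flip k z}) (v : TreeNode K) :
    Measurable (doubleWeight Hit Flip w v) :=
  (((measurable_pairWeight hH _ _).add (measurable_pairWeight hH _ _)).add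
    (measurable_pairWeight hH _ _)).add (measurable_hitWeight hF v)

end Weights

section Tail

variable {Ω : Type*} {mΩ : MeasurableSpace Ω} {P : Measure Ω} {K : ℕ}
  {X : ℕ → Fin K → ℕ → Ω → ℝ} {Hit Flip : Fin K → ℝ → Prop} {w : Fin K → ℝ≥0∞} {q r : ℝ≥0∞}
  {n : ℕ}

theorem lintegral_indicator_meanVar (hX : ∀ t k j, Measurable (X t k j))
    (hH : ∀ k, MeasurableSet {z | Hit k z}) (t : ℕ) (k : Fin K) :
    ∫⁻ ω, w k * {z | Hit k z}.indicator 1 (meanVar X n t k ω) ∂P =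
      w k * P {ω | Hit k (meanVar X n t k ω)} := by
  have h1 : MeasurableSet {ω | Hit k (meanVar X n t k ω)} := measurable_meanVar' hX n t k (hH k)
  have h2 : ∀ ω, ({z | Hit k z}.indicator 1 (meanVar X n t k ω) : ℝ≥0∞) =
      {ω | Hit k (meanVar X n t k ω)}.indicator 1 ω := fun ω => rfl
  simp_rw [h2]
  rw [lintegral_const_mul _ (measurable_one.indicator h1), lintegral_indicator_one h1]

theorem lintegral_hitWeight_le (hX : ∀ t k j, Measurable (X t k j))
    (hH : ∀ k, MeasurableSet {z | Hit k z})
    (hq : ∀ t k, w k * P {ω | Hit k (meanVar X n t k ω)} ≤ q) (t : ℕ) (v : TreeNode K) :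
    ∫⁻ ω, hitWeight Hit w v (fun k => meanVar X n t k ω) ∂P ≤ 3 * q := by
  unfold hitWeight
  rw [lintegral_finsetSum]
  · simp_rw [lintegral_indicator_meanVar hX hH]
    refine (Finset.sum_le_sum fun i _ => hq t (v.arm i)).trans (le_of_eq ?_)
    simp
  · intro i _
    exact (measurable_comp_pi (measurable_meanVar' hX n t)
      (measurable_indicator_apply (hH _) _)).const_mul _

theorem lintegral_pairWeight_le (hX : ∀ t k j, Measurable (X t k j))
    (hindep : iIndepFun (fun q : ℕ × Fin K × ℕ => X q.1 q.2.1 q.2.2) P)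
    (hH : ∀ k, MeasurableSet {z | Hit k z})
    (hq : ∀ t k, w k * P {ω | Hit k (meanVar X n t k ω)} ≤ q) (t : ℕ) (k l : Fin K) :
    ∫⁻ ω, pairWeight Hit w k l (fun k => meanVar X n t k ω) ∂P ≤ q ^ 2 := by
  unfold pairWeight
  by_cases h : k = l
  · simp [h]
  simp only [if_neg h]
  have hm : ∀ k, Measurable[sampleInfo X {i | i.2.1 = k}] fun ω =>
      w k * ({z | Hit k z}.indicator 1 (meanVar X n t k ω) : ℝ≥0∞) := fun k =>
    (((measurable_const (a := (1 : ℝ≥0∞))).indicator (hH k)).comp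
      (measurable_meanVar (S := {i | i.2.1 = k}) fun j => rfl)).const_mul _
  rw [lintegral_mul_eq_lintegral_mul_lintegral_of_independent_measurableSpace
    (sampleInfo_le hX _) (sampleInfo_le hX _) (indep_sampleInfo hX hindep ?_) (hm k) (hm l)]
  · rw [lintegral_indicator_meanVar hX hH, lintegral_indicator_meanVar hX hH, sq]
    exact mul_le_mul' (hq t k) (hq t l)
  · rw [Set.disjoint_left]
    rintro i hi hi'
    exact h (hi.symm.trans hi')

theorem lintegral_doubleWeight_le (hX : ∀ t k j, Measurable (X t k j))
    (hindep : iIndepFun (fun q : ℕ × Fin K × ℕ => X q.1 q.2.1 q.2.2) P)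
    (hH : ∀ k, MeasurableSet {z | Hit k z}) (hF : ∀ k, MeasurableSet {z | Flip k z})
    (hq : ∀ t k, w k * P {ω | Hit k (meanVar X n t k ω)} ≤ q)
    (hr : ∀ t k, w k * P {ω | Flip k (meanVar X n t k ω)} ≤ r) (t : ℕ) (v : TreeNode K) :
    ∫⁻ ω, doubleWeight Hit Flip w v (fun k => meanVar X n t k ω) ∂P ≤ 3 * (q ^ 2 + r) := by
  have hmp : ∀ k l, Measurable fun ω => pairWeight Hit w k l (fun k => meanVar X n t k ω) :=
    fun k l => measurable_comp_pi (measurable_meanVar' hX n t) (measurable_pairWeight hH k l)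
  have hp := fun k l => lintegral_pairWeight_le hX hindep hH hq t k l
  have hf := lintegral_hitWeight_le hX hF hr t v
  unfold doubleWeight
  rw [lintegral_add_left (((hmp _ _).fun_add (hmp _ _)).fun_add (hmp _ _)),
    lintegral_add_left ((hmp _ _).fun_add (hmp _ _)), lintegral_add_left (hmp _ _)]
  refine (add_le_add (add_le_add (add_le_add (hp _ _) (hp _ _)) (hp _ _)) hf).trans (le_of_eq ?_)
  ring

/-- The probability that the misleading observations reach a total severity `j`, one of them
having weight at least `W`. -/
theorem mul_measure_hitLevel_le [IsProbabilityMeasure P] [NeZero K] {τ : ℝ}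
    (hX : ∀ t k j, Measurable (X t k j))
    (hindep : iIndepFun (fun q : ℕ × Fin K × ℕ => X q.1 q.2.1 q.2.2) P)
    (hH : ∀ k, MeasurableSet {z | Hit k z}) (hF : ∀ k, MeasurableSet {z | Flip k z})
    (hq : ∀ t k, w k * P {ω | Hit k (meanVar X n t k ω)} ≤ q)
    (hr : ∀ t k, w k * P {ω | Flip k (meanVar X n t k ω)} ≤ r) {q' : ℝ≥0∞} (hqq : q ≤ q')
    (hqr : q ^ 2 + r ≤ q' ^ 2) (hw : ∀ k, 1 ≤ w k) (hf : ∀ k z, Flip k z → Hit k z)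
    {W : ℝ≥0∞} (hW : ∀ k z, Flip k z → W ≤ w k) (T j : ℕ) (hj : 1 ≤ j) {S : Set Ω}
    (hS : ∀ ω ∈ S, j ≤ ∑ s ∈ Finset.range T, hitLevel Hit Flip
      (exploreNode τ (fun s k => meanVar X n s k ω) s) (fun k => meanVar X n s k ω))
    (hS' : ∀ ω ∈ S, ∃ t < T, ∃ i,
      W ≤ w ((exploreNode τ (fun s k => meanVar X n s k ω) t).arm i) ∧
      Hit ((exploreNode τ (fun s k => meanVar X n s k ω) t).arm i)
        (meanVar X n t ((exploreNode τ (fun s k => meanVar X n s k ω) t).arm i) ω)) :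
    W * P S ≤ ((3 * T).choose j : ℝ≥0∞) * q' ^ j := by
  have hA : ∀ p, Measurable (hitWeight Hit w (TreeNode.ofPath K p)) :=
    fun p => measurable_hitWeight hH _
  have hB : ∀ p, Measurable (doubleWeight Hit Flip w (TreeNode.ofPath K p)) :=
    fun p => measurable_doubleWeight hH hF _
  have hint := lintegral_levelSum_le (τ := τ) (P := P) (m := meanVar X n)
    (past := fun t => sampleInfo X {i | i.1 < t}) (pres := fun t => sampleInfo X {i | i.1 = t})
    (fun t => sampleInfo_le hX _) (fun t => sampleInfo_le hX _)
    (fun t => indep_sampleInfo hX hindep (by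
      rw [Set.disjoint_left]
      intro i hi hi'
      exact absurd hi' (ne_of_lt hi)))
    (fun t s hs k => measurable_meanVar fun _ => hs)
    (fun t k => measurable_meanVar fun _ => rfl) hA hB
    (q := q')
    (fun t p => (lintegral_hitWeight_le hX hH hq t _).trans (by gcongr))
    (fun t p => (lintegral_doubleWeight_le hX hindep hH hF hq hr t _).trans (by gcongr)) T j
  refine le_trans ?_ hint
  have hmeas := measurable_levelSum (Ω := Ω)
    (a := fun s ω => hitWeight Hit w (TreeNode.ofPath K
      (explorePath τ (fun s k => meanVar X n s k ω) s)) (fun k => meanVar X n s k ω))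
    (b := fun s ω => doubleWeight Hit Flip w (TreeNode.ofPath K
      (explorePath τ (fun s k => meanVar X n s k ω) s)) (fun k => meanVar X n s k ω)) T
    (fun s _ => measurable_comp_explorePath (fun i _ k => measurable_meanVar' hX n i k) hA)
    (fun s _ => measurable_comp_explorePath (fun i _ k => measurable_meanVar' hX n i k) hB) j
  refine le_trans ?_ (mul_meas_ge_le_lintegral hmeas W)
  gcongr
  intro ω hω
  obtain ⟨t, ht, i, hWi, hi⟩ := hS' ω hω
  have hone : ∀ s, 1 ≤ hitLevel Hit Flip (exploreNode τ (fun s k => meanVar X n s k ω) s)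
      (fun k => meanVar X n s k ω) → ∃ i, Hit
        ((exploreNode τ (fun s k => meanVar X n s k ω) s).arm i)
        (meanVar X n s ((exploreNode τ (fun s k => meanVar X n s k ω) s).arm i) ω) :=
    fun s hs => exists_hit_of_one_le_hitLevel hf hs
  refine le_levelSum (n := fun s => hitLevel Hit Flip
      (exploreNode τ (fun s k => meanVar X n s k ω) s) (fun k => meanVar X n s k ω)) (r := t)
    (fun s => hitLevel_le_two _ _) ?_ ?_ (one_le_hitLevel hi) ?_ ?_ T ht j hj (hS ω hω)
  · intro s hs
    obtain ⟨i, hi⟩ := hone s hs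
    exact (hw _).trans (le_hitWeight hi)
  · intro s hs
    obtain ⟨i, hi⟩ := hone s (by rw [hs]; norm_num)
    exact le_doubleWeight_of_hitLevel hw (fun k _ _ => hw k) hi (hw _) hs
  · exact hWi.trans (le_hitWeight hi)
  · exact fun h => le_doubleWeight_of_hitLevel hw hW hi hWi h

end Tail

end MTB

end

noncomputable section

namespace MTB

open scoped ENNReal

section Hits

variable {K : ℕ} [NeZero K] {x : Fin K → ℝ} {e₀ ε τ d d' : ℝ} {k : Fin K} {y : ℝ}

/-- The observation `y` of arm `k` is off by at least `d` away from `τ`. -/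
def Overshoots (x : Fin K → ℝ) (τ d : ℝ) (k : Fin K) (y : ℝ) : Prop :=
  (IsPos x k → x k + d ≤ y - τ) ∧ (¬ IsPos x k → y - τ ≤ x k - d)

open Classical in
/-- The misleading observations: by `e₀` away from or by `2 e₀` towards `τ` for the arms within `e₀`
of `τ`, and towards `τ` by `ε - 2 e₀` for the far arms, and by `e₀` for the others. -/
def Misleads (x : Fin K → ℝ) (e₀ ε τ : ℝ) (k : Fin K) (y : ℝ) : Prop :=
  if |x k| ≤ e₀ then Deviates x τ (2 * e₀) k y ∨ Overshoots x τ e₀ k y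
  else Deviates x τ (if ε ≤ |x k| then ε - 2 * e₀ else e₀) k y

/-- The observations of far arms that are off by `ε`. -/
def FarFlip (x : Fin K → ℝ) (ε τ : ℝ) (k : Fin K) (y : ℝ) : Prop :=
  ε ≤ |x k| ∧ Deviates x τ ε k y

theorem Deviates.mono (h : Deviates x τ d k y) (hd : d' ≤ d) : Deviates x τ d' k y :=
  ⟨fun hk => (h.1 hk).trans (by linarith), fun hk => le_trans (by linarith) (h.2 hk)⟩

theorem lt_of_not_deviates (h : ¬ Deviates x τ d k y) :
    (IsPos x k → x k - d < y - τ) ∧ (¬ IsPos x k → y - τ < x k + d) := by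
  constructor
  · intro hk
    by_contra hle
    exact h ⟨fun _ => not_lt.mp hle, fun hk' => absurd hk hk'⟩
  · intro hk
    by_contra hle
    exact h ⟨fun hk' => absurd hk' hk, fun _ => not_lt.mp hle⟩

theorem lt_of_not_overshoots (h : ¬ Overshoots x τ d k y) :
    (IsPos x k → y - τ < x k + d) ∧ (¬ IsPos x k → x k - d < y - τ) := by
  constructor
  · intro hk
    by_contra hle
    exact h ⟨fun _ => not_lt.mp hle, fun hk' => absurd hk hk'⟩
  · intro hk
    by_contra hle
    exact h ⟨fun hk' => absurd hk' hk, fun _ => not_lt.mp hle⟩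

theorem Crossing.signRight_of_not_deviates (h : Crossing x ε) (hd : d ≤ |x k|)
    (hn : ¬ Deviates x τ d k y) : SignRight x τ k y := by
  obtain ⟨h1, h2⟩ := lt_of_not_deviates hn
  constructor
  · intro hk
    rw [abs_of_nonneg (h.nonneg hk)] at hd
    linarith [h1 hk]
  · intro hk
    rw [abs_of_nonpos (nonpos_of_not_isPos hk)] at hd
    linarith [h2 hk]

theorem Crossing.hitSpec (h : Crossing x ε) (he : 0 < e₀) (he3 : 3 * e₀ ≤ ε) :
    HitSpec x e₀ ε τ (Misleads x e₀ ε τ) (FarFlip x ε τ) where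
  near k y hk hn := by
    unfold Misleads at hn
    rw [if_pos hk, not_or] at hn
    obtain ⟨h1, h2⟩ := lt_of_not_deviates hn.1
    obtain ⟨h3, h4⟩ := lt_of_not_overshoots hn.2
    rw [abs_le] at hk ⊢
    by_cases hp : IsPos x k
    · have := h.nonneg hp
      constructor
      · linarith [h1 hp]
      · linarith [h3 hp]
    · have := nonpos_of_not_isPos hp
      constructor
      · linarith [h4 hp]
      · linarith [h2 hp]
  sign k y hk hn := by
    unfold Misleads at hn
    rw [if_neg (not_le.mpr hk)] at hn
    refine h.signRight_of_not_deviates ?_ hn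
    split_ifs with hf
    · linarith
    · exact hk.le
  far k y hk hn := by
    unfold Misleads at hn
    rw [if_neg (by linarith), if_pos hk] at hn
    obtain ⟨h1, h2⟩ := lt_of_not_deviates hn
    by_cases hp : IsPos x k
    · rw [abs_of_nonneg (h.nonneg hp)] at hk
      exact lt_abs.mpr (Or.inl (by linarith [h1 hp]))
    · rw [abs_of_nonpos (nonpos_of_not_isPos hp)] at hk
      exact lt_abs.mpr (Or.inr (by linarith [h2 hp]))
  flip k y hk hn := h.signRight_of_not_deviates hk fun hd => hn ⟨hk, hd⟩
  hit_of_flip k y hf := by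
    refine ⟨?_, hf.1⟩
    unfold Misleads
    rw [if_neg (by linarith [hf.1]), if_pos hf.1]
    exact hf.2.mono (by linarith)

theorem measurableSet_deviates (k : Fin K) : MeasurableSet {y | Deviates x τ d k y} := by
  unfold Deviates
  by_cases hk : IsPos x k
  · simp only [hk, forall_const, not_true_eq_false, false_imp_iff, and_true]
    exact measurableSet_le (measurable_id.sub_const τ) measurable_const
  · simp only [hk, forall_const, not_false_eq_true, false_imp_iff, true_and]
    exact measurableSet_le measurable_const (measurable_id.sub_const τ)

theorem measurableSet_overshoots (k : Fin K) : MeasurableSet {y | Overshoots x τ d k y} := by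
  unfold Overshoots
  by_cases hk : IsPos x k
  · simp only [hk, forall_const, not_true_eq_false, false_imp_iff, and_true]
    exact measurableSet_le measurable_const (measurable_id.sub_const τ)
  · simp only [hk, forall_const, not_false_eq_true, false_imp_iff, true_and]
    exact measurableSet_le (measurable_id.sub_const τ) measurable_const

theorem measurableSet_misleads (k : Fin K) : MeasurableSet {y | Misleads x e₀ ε τ k y} := by
  unfold Misleads
  split_ifs
  · exact (measurableSet_deviates k).union (measurableSet_overshoots k)
  · exact measurableSet_deviates k
  · exact measurableSet_deviates k

theorem measurableSet_farFlip (k : Fin K) : MeasurableSet {y | FarFlip x ε τ k y} :=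
  (MeasurableSet.const _).inter (measurableSet_deviates k)

end Hits

section Bandit

variable {Ω : Type*} {mΩ : MeasurableSpace Ω} {P : Measure Ω} [IsProbabilityMeasure P] {K : ℕ}
  [NeZero K] {X : ℕ → Fin K → ℕ → Ω → ℝ} {ν : Fin K → Measure ℝ} {σ τ e₀ ε : ℝ} {n : ℕ}

theorem measure_overshoots_le
    (hσ : 0 < σ) (hsub : ∀ k, IsSubGaussian σ (ν k)) (hX : ∀ t k j, Measurable (X t k j))
    (hlaw : ∀ t k j, P.map (X t k j) = ν k)
    (hindep : iIndepFun (fun q : ℕ × Fin K × ℕ => X q.1 q.2.1 q.2.2) P) (hn : 1 ≤ n)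
    {d : ℝ} (hd : 0 ≤ d) (t : ℕ) (k : Fin K) :
    P {ω | Overshoots (fun k => armMean ν k - τ) τ d k (meanVar X n t k ω)} ≤
      ENNReal.ofReal (Real.exp (-(n * d ^ 2 / (2 * σ ^ 2)))) := by
  by_cases hk : IsPos (fun k => armMean ν k - τ) k
  · refine le_trans (measure_mono fun ω hω => ?_)
      (measure_meanVar_ge_le hσ hsub hX hlaw hindep hn hd t k)
    have := hω.1 hk
    simp only [Set.mem_ofPred_eq]
    linarith
  · refine le_trans (measure_mono fun ω hω => ?_)
      (measure_meanVar_le_le hσ hsub hX hlaw hindep hn hd t k)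
    have := hω.2 hk
    simp only [Set.mem_ofPred_eq]
    linarith

/-- The probability that the misleading observations reach a total severity `j`, one of them at a
far arm if `W` is not `1`. -/
theorem mul_measure_misleads_le
    (hσ : 0 < σ) (hsub : ∀ k, IsSubGaussian σ (ν k)) (hX : ∀ t k j, Measurable (X t k j))
    (hlaw : ∀ t k j, P.map (X t k j) = ν k)
    (hindep : iIndepFun (fun q : ℕ × Fin K × ℕ => X q.1 q.2.1 q.2.2) P) (hn : 1 ≤ n)
    (he : 0 < e₀) (he48 : n * e₀ ^ 2 / (2 * σ ^ 2) = Real.log 48) (he3 : 3 * e₀ ≤ ε)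
    {W : ℝ} (hW1 : 1 ≤ W)
    (hW : W * Real.exp (-(n * (ε - 2 * e₀) ^ 2 / (2 * σ ^ 2))) ≤ 1 / 48)
    (T j : ℕ) (hj : 1 ≤ j) {S : Set Ω}
    (hS : ∀ ω ∈ S, j ≤ ∑ s ∈ Finset.range T,
      hitLevel (Misleads (fun k => armMean ν k - τ) e₀ ε τ) (FarFlip (fun k => armMean ν k - τ) ε τ)
      (exploreNode τ (fun s k => meanVar X n s k ω) s) (fun k => meanVar X n s k ω))
    (hS' : W = 1 ∨ ∀ ω ∈ S, ∃ t < T, ∃ i,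
      ε ≤ |armMean ν ((exploreNode τ (fun s k => meanVar X n s k ω) t).arm i) - τ| ∧
      Misleads (fun k => armMean ν k - τ) e₀ ε τ
        ((exploreNode τ (fun s k => meanVar X n s k ω) t).arm i)
        (meanVar X n t ((exploreNode τ (fun s k => meanVar X n s k ω) t).arm i) ω)) :
    W * P.real S ≤ ((3 * T).choose j : ℝ) * (10 / 479) ^ j := by
  classical
  have hdev := fun {d : ℝ} (hd : 0 ≤ d) => measure_deviates_le (τ := τ) hσ hsub hX hlaw hindep hn hd
  have hover := fun {d : ℝ} (hd : 0 ≤ d) =>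
    measure_overshoots_le (τ := τ) hσ hsub hX hlaw hindep hn hd
  have hW0 : 0 ≤ W := by linarith
  have hσ2 : 0 < 2 * σ ^ 2 := by positivity
  have hexp : ∀ m : ℕ, Real.exp (-(m * Real.log 48)) = (1 / 48) ^ m := by
    intro m
    rw [show -(m * Real.log 48) = (m : ℝ) * Real.log (1 / 48) by
      rw [one_div, Real.log_inv]; ring, Real.exp_nat_mul, Real.exp_log (by norm_num)]
  have hE0 : Real.exp (-(n * e₀ ^ 2 / (2 * σ ^ 2))) = 1 / 48 := by
    rw [he48]
    simpa using hexp 1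
  have hE2 : Real.exp (-(n * (2 * e₀) ^ 2 / (2 * σ ^ 2))) = (1 / 48) ^ 4 := by
    rw [show n * (2 * e₀) ^ 2 / (2 * σ ^ 2) = 4 * (n * e₀ ^ 2 / (2 * σ ^ 2)) by ring, he48]
    exact_mod_cast hexp 4
  have hEε : W * Real.exp (-(n * ε ^ 2 / (2 * σ ^ 2))) ≤ (1 / 48) ^ 9 := by
    have h1 : Real.exp (-(n * ε ^ 2 / (2 * σ ^ 2))) ≤
        Real.exp (-(n * (ε - 2 * e₀) ^ 2 / (2 * σ ^ 2))) * (1 / 48) ^ 8 := by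
      rw [← hexp 8, ← Real.exp_add]
      apply Real.exp_le_exp.mpr
      rw [← he48]
      have h2 : n * ε ^ 2 / (2 * σ ^ 2) - n * (ε - 2 * e₀) ^ 2 / (2 * σ ^ 2) -
          8 * (n * e₀ ^ 2 / (2 * σ ^ 2)) = (n / (2 * σ ^ 2)) * (4 * e₀ * (ε - 3 * e₀)) := by ring
      have h3 : 0 ≤ (n / (2 * σ ^ 2)) * (4 * e₀ * (ε - 3 * e₀)) :=
        mul_nonneg (by positivity) (mul_nonneg (by positivity) (by linarith))
      push_cast
      linarith
    calc W * Real.exp (-(n * ε ^ 2 / (2 * σ ^ 2)))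
        ≤ W * (Real.exp (-(n * (ε - 2 * e₀) ^ 2 / (2 * σ ^ 2))) * (1 / 48) ^ 8) := by gcongr
      _ = (W * Real.exp (-(n * (ε - 2 * e₀) ^ 2 / (2 * σ ^ 2)))) * (1 / 48) ^ 8 := by ring
      _ ≤ 1 / 48 * (1 / 48) ^ 8 := by gcongr
      _ = (1 / 48) ^ 9 := by ring
  set x : Fin K → ℝ := fun k => armMean ν k - τ with hx
  let w : Fin K → ℝ≥0∞ := fun k => if ε ≤ |x k| then ENNReal.ofReal W else 1
  have hw1 : ∀ k, 1 ≤ w k := by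
    intro k
    simp only [w]
    split_ifs
    · exact ENNReal.one_le_ofReal.mpr hW1
    · exact le_rfl
  have hq : ∀ t k, w k * P {ω | Misleads x e₀ ε τ k (meanVar X n t k ω)} ≤
      ENNReal.ofReal (1 / 48 + (1 / 48) ^ 4) := by
    intro t k
    have hle : ENNReal.ofReal (1 / 48) ≤ ENNReal.ofReal (1 / 48 + (1 / 48) ^ 4) :=
      ENNReal.ofReal_le_ofReal (by norm_num)
    simp only [w, Misleads]
    by_cases h1 : |x k| ≤ e₀
    · simp only [h1, if_true]
      rw [if_neg (by linarith), one_mul]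
      have h2 := hdev (d := 2 * e₀) (by linarith) t k
      have h3 := hover (d := e₀) he.le t k
      rw [hE2] at h2
      rw [hE0] at h3
      rw [add_comm, ENNReal.ofReal_add (by norm_num) (by norm_num)]
      exact (measure_union_le _ _).trans (add_le_add h2 h3)
    · simp only [h1, if_false]
      refine le_trans ?_ hle
      by_cases h2 : ε ≤ |x k|
      · simp only [h2, if_true]
        refine (mul_le_mul_right (hdev (d := ε - 2 * e₀) (by linarith) t k) _).trans ?_
        rw [← ENNReal.ofReal_mul hW0]
        exact ENNReal.ofReal_le_ofReal hW
      · simp only [h2, if_false, one_mul]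
        have h3 := hdev (d := e₀) he.le t k
        rwa [hE0] at h3
  have hr : ∀ t k, w k * P {ω | FarFlip x ε τ k (meanVar X n t k ω)} ≤
      ENNReal.ofReal ((1 / 48) ^ 9) := by
    intro t k
    simp only [w, FarFlip]
    by_cases h2 : ε ≤ |x k|
    · simp only [h2, if_true, true_and]
      refine (mul_le_mul_right (hdev (d := ε) (by linarith) t k) _).trans ?_
      rw [← ENNReal.ofReal_mul hW0]
      exact ENNReal.ofReal_le_ofReal hEε
    · simp [h2]
  have hflip : ∀ k z, FarFlip x ε τ k z → Misleads x e₀ ε τ k z := by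
    intro k z hf
    unfold Misleads
    rw [if_neg (by linarith [hf.1]), if_pos hf.1]
    exact hf.2.mono (by linarith)
  have hkey := mul_measure_hitLevel_le (τ := τ) (w := w) (W := ENNReal.ofReal W)
    (q' := ENNReal.ofReal (10 / 479)) hX hindep
    measurableSet_misleads measurableSet_farFlip hq hr
    (ENNReal.ofReal_le_ofReal (by norm_num))
    (by
      rw [← ENNReal.ofReal_pow (by norm_num), ← ENNReal.ofReal_pow (by norm_num),
        ← ENNReal.ofReal_add (by norm_num) (by norm_num)]
      exact ENNReal.ofReal_le_ofReal (by norm_num))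
    hw1 hflip (fun k z hf => by simp only [w]; rw [if_pos hf.1]) T j hj hS (by
      intro ω hω
      rcases hS' with h1 | h1
      · have h2 := hS ω hω
        obtain ⟨s, hs, hs'⟩ : ∃ s ∈ Finset.range T, hitLevel (Misleads x e₀ ε τ) (FarFlip x ε τ)
            (exploreNode τ (fun s k => meanVar X n s k ω) s) (fun k => meanVar X n s k ω) ≠ 0 := by
          apply Finset.exists_ne_zero_of_sum_ne_zero
          omega
        obtain ⟨i, hi⟩ := exists_hit_of_one_le_hitLevel hflip (Nat.one_le_iff_ne_zero.mpr hs')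
        refine ⟨s, Finset.mem_range.mp hs, i, ?_, hi⟩
        rw [h1, ENNReal.ofReal_one]
        exact hw1 _
      · obtain ⟨t, ht, i, hi, hi'⟩ := h1 ω hω
        refine ⟨t, ht, i, ?_, hi'⟩
        simp only [w]
        rw [if_pos (by exact hi)])
  have h2 := ENNReal.toReal_mono (by finiteness) hkey
  rw [ENNReal.toReal_mul, ENNReal.toReal_mul, ENNReal.toReal_ofReal hW0, ENNReal.toReal_natCast,
    ENNReal.toReal_pow, ENNReal.toReal_ofReal (by norm_num)] at h2
  exact h2

/-- The probability that some observation of `Explore` is off by `d` towards `τ`. -/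
theorem measure_exists_deviates_le
    (hσ : 0 < σ) (hsub : ∀ k, IsSubGaussian σ (ν k)) (hX : ∀ t k j, Measurable (X t k j))
    (hlaw : ∀ t k j, P.map (X t k j) = ν k)
    (hindep : iIndepFun (fun q : ℕ × Fin K × ℕ => X q.1 q.2.1 q.2.2) P) (hn : 1 ≤ n)
    {d : ℝ} (hd : 0 ≤ d) (T : ℕ) :
    P.real {ω | ∃ t < T, ∃ i, Deviates (fun k => armMean ν k - τ) τ d
      ((exploreNode τ (fun s k => meanVar X n s k ω) t).arm i)
      (meanVar X n t ((exploreNode τ (fun s k => meanVar X n s k ω) t).arm i) ω)} ≤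
      3 * T * Real.exp (-(n * d ^ 2 / (2 * σ ^ 2))) := by
  have hkey := mul_measure_hitLevel_le (τ := τ) (w := fun _ => 1) (W := 1)
    (Hit := Deviates (fun k => armMean ν k - τ) τ d) (Flip := fun _ _ => False) (r := 0) hX hindep
    measurableSet_deviates (fun _ => MeasurableSet.const False)
    (fun t k => by
      rw [one_mul]
      exact measure_deviates_le (τ := τ) hσ hsub hX hlaw hindep hn hd t k)
    (fun t k => by simp) le_rfl (by simp) (fun _ => le_rfl) (fun _ _ h => h.elim)
    (fun _ _ h => h.elim) T 1 le_rfl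
    (S := {ω | ∃ t < T, ∃ i, Deviates (fun k => armMean ν k - τ) τ d
      ((exploreNode τ (fun s k => meanVar X n s k ω) t).arm i)
      (meanVar X n t ((exploreNode τ (fun s k => meanVar X n s k ω) t).arm i) ω)})
    (by
      rintro ω ⟨t, ht, i, hi⟩
      refine le_trans (one_le_hitLevel hi) (Finset.single_le_sum
        (f := fun s => hitLevel (Deviates (fun k => armMean ν k - τ) τ d) (fun _ _ => False)
          (exploreNode τ (fun s k => meanVar X n s k ω) s) (fun k => meanVar X n s k ω))
        (fun _ _ => Nat.zero_le _) (Finset.mem_range.mpr ht)))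
    (by
      rintro ω ⟨t, ht, i, hi⟩
      exact ⟨t, ht, i, le_rfl, hi⟩)
  rw [one_mul, Nat.choose_one_right, pow_one] at hkey
  have h2 := ENNReal.toReal_mono (by finiteness) hkey
  rw [ENNReal.toReal_mul, ENNReal.toReal_ofReal (Real.exp_nonneg _), ENNReal.toReal_natCast] at h2
  push_cast at h2
  exact h2

end Bandit

end MTB

end

noncomputable section

namespace MTB

theorem log_three_gt : 1.09 < Real.log 3 := by
  have h1 : Real.log ((2 : ℝ) ^ 19) ≤ Real.log ((3 : ℝ) ^ 12) :=
    Real.log_le_log (by norm_num) (by norm_num)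
  rw [Real.log_pow, Real.log_pow] at h1
  push_cast at h1
  linarith [Real.log_two_gt_d9]

theorem log_four_gt : 1.386 < Real.log 4 := by
  have h1 : Real.log 4 = 2 * Real.log 2 := by
    rw [show (4 : ℝ) = 2 ^ 2 by norm_num, Real.log_pow]
    norm_num
  linarith [Real.log_two_gt_d9]

theorem log_three_lt : Real.log 3 < 7 / 6 := by
  have h1 : Real.log ((3 : ℝ) ^ 5) ≤ Real.log ((2 : ℝ) ^ 8) :=
    Real.log_le_log (by norm_num) (by norm_num)
  rw [Real.log_pow, Real.log_pow] at h1
  push_cast at h1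
  linarith [Real.log_two_lt_d9]

theorem six_log_le_roundCount (K : ℕ) : 6 * Real.log K ≤ roundCount K := Nat.le_ceil _

theorem roundCount_lt {K : ℕ} (hK : 3 ≤ K) : (roundCount K : ℝ) < 6 * Real.log K + 1 :=
  Nat.ceil_lt_add_one (mul_nonneg (by norm_num) (Real.log_nonneg (by
    have : (3 : ℝ) ≤ K := by exact_mod_cast hK
    linarith)))

theorem log_ge_of_three_le {K : ℕ} (hK : 3 ≤ K) : 1.09 < Real.log K :=
  log_three_gt.trans_le (Real.log_le_log (by norm_num) (by exact_mod_cast hK))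

theorem log_ge_of_four_le {K : ℕ} (hK : 4 ≤ K) : 1.386 < Real.log K :=
  log_four_gt.trans_le (Real.log_le_log (by norm_num) (by exact_mod_cast hK))

theorem roundCount_three : roundCount 3 = 7 := by
  have h1 := six_log_le_roundCount 3
  have h2 := roundCount_lt (K := 3) le_rfl
  have h3 := log_three_gt
  have h4 := log_three_lt
  push_cast at h1 h2
  have h5 : (6 : ℝ) < roundCount 3 := by linarith
  have h6 : (roundCount 3 : ℝ) < 8 := by linarith
  have h7 : 6 < roundCount 3 := by exact_mod_cast h5
  have h8 : roundCount 3 < 8 := by exact_mod_cast h6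
  omega

theorem nine_le_roundCount {K : ℕ} (hK : 4 ≤ K) : 9 ≤ roundCount K := by
  have h1 := six_log_le_roundCount K
  have h2 := log_ge_of_four_le hK
  have h5 : (8 : ℝ) < roundCount K := by linarith
  have h6 : 8 < roundCount K := by exact_mod_cast h5
  omega

theorem five_mul_le_log_two_pow_add (D : ℕ) :
    5 * ((D : ℝ) + 1) ≤ 9 * Real.log ((2 ^ D + 2 : ℕ) : ℝ) := by
  have l2 := Real.log_two_gt_d9
  have l3 := log_three_gt
  by_cases hD : D < 5
  · interval_cases D
    · norm_num
      linarith
    · norm_num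
      linarith [log_four_gt]
    · have : Real.log 6 = Real.log 2 + Real.log 3 := by
        rw [← Real.log_mul (by norm_num) (by norm_num)]
        norm_num
      norm_num
      linarith
    · have h1 : Real.log ((2 : ℝ) ^ 43) ≤ Real.log ((10 : ℝ) ^ 13) :=
        Real.log_le_log (by norm_num) (by norm_num)
      rw [Real.log_pow, Real.log_pow] at h1
      push_cast at h1
      norm_num
      linarith
    · have : Real.log 18 = Real.log 2 + Real.log 3 + Real.log 3 := by
        rw [← Real.log_mul (by norm_num) (by norm_num), ← Real.log_mul (by norm_num) (by norm_num)]
        norm_num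
      norm_num
      linarith
  · have hD' : (5 : ℝ) ≤ D := by exact_mod_cast not_lt.mp hD
    have h1 : Real.log ((2 : ℝ) ^ D) ≤ Real.log ((2 ^ D + 2 : ℕ) : ℝ) := by
      apply Real.log_le_log (by positivity)
      push_cast
      linarith
    rw [Real.log_pow] at h1
    nlinarith

theorem ten_mul_clog_le {K : ℕ} (hK : 3 ≤ K) : 10 * Nat.clog 2 (K - 1) ≤ 3 * roundCount K := by
  obtain ⟨D, hD⟩ : ∃ D, Nat.clog 2 (K - 1) = D + 1 :=
    ⟨Nat.clog 2 (K - 1) - 1, by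
      have := Nat.clog_pos (b := 2) (n := K - 1) (by norm_num) (by omega)
      omega⟩
  have h1 : 2 ^ D + 2 ≤ K := by
    have := Nat.pow_pred_clog_lt_self (b := 2) (x := K - 1) (by norm_num) (by omega)
    rw [hD] at this
    simp only [Nat.pred_succ] at this
    omega
  have h2 := five_mul_le_log_two_pow_add D
  have h3 : Real.log ((2 ^ D + 2 : ℕ) : ℝ) ≤ Real.log K :=
    Real.log_le_log (by positivity) (by exact_mod_cast h1)
  have h4 := six_log_le_roundCount K
  rw [hD]
  have : (10 : ℝ) * (D + 1) ≤ 3 * roundCount K := by linarith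
  exact_mod_cast this

theorem choose_mul_pow_le (m n : ℕ) {z : ℝ} (hz : 0 ≤ z) :
    (m.choose n : ℝ) * z ^ n ≤ (1 + z) ^ m := by
  rcases le_or_gt n m with h | h
  · rw [add_comm, add_pow]
    have := Finset.single_le_sum (f := fun i => z ^ i * 1 ^ (m - i) * (m.choose i : ℝ))
      (s := Finset.range (m + 1)) (fun i _ => by positivity)
      (Finset.mem_range.mpr (Nat.lt_succ_of_le h))
    simp only [one_pow, mul_one] at this ⊢
    linarith
  · rw [Nat.choose_eq_zero_of_lt h]
    simp only [Nat.cast_zero, zero_mul]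
    positivity

/-- The number of misleading observations that a wrong output needs in `T` rounds. -/
def hitBound (T : ℕ) : ℕ := (7 * T + 19) / 20

theorem choose_hitBound_le (T : ℕ) :
    ((3 * T).choose (hitBound T) : ℝ) * (10 / 479) ^ hitBound T ≤ (763 / 1000) ^ T := by
  have hn : 7 * T ≤ 20 * hitBound T := by
    unfold hitBound
    omega
  generalize hitBound T = n at hn ⊢
  have h1 := choose_mul_pow_le (3 * T) n (z := 3 / 20) (by norm_num)
  have h2 : (10 / 479 : ℝ) ^ n = (3 / 20) ^ n * (200 / 1437) ^ n := by
    rw [← mul_pow]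
    norm_num
  rw [h2, ← mul_assoc]
  refine (mul_le_mul_of_nonneg_right h1 (by positivity)).trans ?_
  apply le_of_pow_le_pow_left₀ (n := 20) (by norm_num) (by positivity)
  calc ((1 + 3 / 20 : ℝ) ^ (3 * T) * (200 / 1437) ^ n) ^ 20
      = (1 + 3 / 20 : ℝ) ^ (60 * T) * (200 / 1437) ^ (20 * n) := by
        rw [mul_pow, ← pow_mul, ← pow_mul]
        ring_nf
    _ ≤ (1 + 3 / 20 : ℝ) ^ (60 * T) * (200 / 1437) ^ (7 * T) := by
        gcongr ?_ * ?_
        exact pow_le_pow_of_le_one (by norm_num) (by norm_num) hn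
    _ = ((1 + 3 / 20 : ℝ) ^ 60 * (200 / 1437) ^ 7) ^ T := by
        rw [mul_pow, ← pow_mul, ← pow_mul]
    _ ≤ ((763 / 1000 : ℝ) ^ 20) ^ T := by
        apply pow_le_pow_left₀ (by positivity)
        norm_num
    _ = ((763 / 1000 : ℝ) ^ T) ^ 20 := by
        rw [← pow_mul, ← pow_mul, mul_comm]

theorem choose_hitBound_le_exp (K : ℕ) :
    ((3 * roundCount K).choose (hitBound (roundCount K)) : ℝ) *
      (10 / 479) ^ hitBound (roundCount K) ≤ Real.exp (-(3 * Real.log K / 4)) := by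
  refine (choose_hitBound_le _).trans ?_
  have h1 : (763 / 1000 : ℝ) ≤ Real.exp (-(1 / 8)) := by
    have := Real.add_one_le_exp (-(1 / 8) : ℝ)
    linarith
  calc (763 / 1000 : ℝ) ^ roundCount K ≤ Real.exp (-(1 / 8)) ^ roundCount K := by gcongr
    _ = Real.exp (roundCount K * -(1 / 8)) := (Real.exp_nat_mul _ _).symm
    _ ≤ _ := by
      apply Real.exp_le_exp.mpr
      linarith [six_log_le_roundCount K]

theorem choose_hitBound_seven :
    48 * (((3 * 7).choose (hitBound 7) : ℝ) * (10 / 479) ^ hitBound 7) ≤ 3 / 5 := by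
  have : Nat.choose 21 3 = 1330 := by decide +kernel
  norm_num [hitBound, this]

theorem choose_hitBound_le_half {T : ℕ} (hT : 9 ≤ T) :
    48 * (((3 * T).choose (hitBound T) : ℝ) * (10 / 479) ^ hitBound T) ≤ 1 / 2 := by
  by_cases h : T < 17
  · have e : ∀ m n : ℕ, m.choose n = m.descFactorial n / n.factorial :=
      Nat.choose_eq_descFactorial_div_factorial
    interval_cases T <;>
    · rw [e]
      norm_num [hitBound, Nat.descFactorial, Nat.factorial]
  · have h1 : (763 / 1000 : ℝ) ^ T ≤ (763 / 1000) ^ 17 :=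
      pow_le_pow_of_le_one (by norm_num) (by norm_num) (not_lt.mp h)
    have h2 : 48 * (763 / 1000 : ℝ) ^ 17 ≤ 1 / 2 := by norm_num
    linarith [choose_hitBound_le T]

theorem exp_mul_log_le {a b : ℝ} (m : ℕ) (hm : m ≠ 0) (hb : 0 ≤ b)
    (h : Real.exp (m * a) ≤ b ^ m) : Real.exp a ≤ b := by
  rw [Real.exp_nat_mul] at h
  exact le_of_pow_le_pow_left₀ hm hb h

theorem exp_five_fourths_log : Real.exp (5 / 4 * Real.log 48) ≤ 127 := by
  apply exp_mul_log_le 4 (by norm_num) (by norm_num)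
  rw [show ((4 : ℕ) : ℝ) * (5 / 4 * Real.log 48) = (5 : ℕ) * Real.log 48 by push_cast; ring,
    Real.exp_nat_mul, Real.exp_log (by norm_num)]
  norm_num

theorem exp_nine_eighths_log : Real.exp (9 / 8 * Real.log 48) ≤ 79 := by
  apply exp_mul_log_le 8 (by norm_num) (by norm_num)
  rw [show ((8 : ℕ) : ℝ) * (9 / 8 * Real.log 48) = (9 : ℕ) * Real.log 48 by push_cast; ring,
    Real.exp_nat_mul, Real.exp_log (by norm_num)]
  norm_num

theorem le_mul_pullCount {K T : ℕ} (h : 1 ≤ pullCount K T) :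
    T ≤ (6 * roundCount K - 1) * pullCount K T := by
  have hd : 0 < 3 * roundCount K := by
    by_contra h0
    unfold pullCount at h
    rw [Nat.eq_zero_of_not_pos h0] at h
    simp at h
  have h1 : T < 3 * roundCount K * (pullCount K T + 1) := by
    have := Nat.lt_mul_div_succ T hd
    exact this
  have h2 : 3 * roundCount K - 1 ≤ (3 * roundCount K - 1) * pullCount K T :=
    Nat.le_mul_of_pos_right _ h
  have h3 : 6 * roundCount K - 1 = 3 * roundCount K + (3 * roundCount K - 1) := by omega
  rw [h3, add_mul]
  rw [mul_add] at h1
  omega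

theorem le_mul_pullCount_real {K T : ℕ} (h : 1 ≤ pullCount K T) :
    (T : ℝ) ≤ (6 * roundCount K - 1) * pullCount K T := by
  have h1 := le_mul_pullCount h
  have h2 : 1 ≤ 6 * roundCount K := by
    by_contra h0
    unfold pullCount at h
    rw [show roundCount K = 0 by omega] at h
    simp at h
  have h3 : (T : ℝ) ≤ ((6 * roundCount K - 1 : ℕ) : ℝ) * pullCount K T := by exact_mod_cast h1
  rw [Nat.cast_sub h2] at h3
  push_cast at h3
  exact h3

/-- The budget per sample: `ρ = T / (18 T₂ log K)` is at most `9 / 4`, and the main term is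
controlled for this `ρ`. -/
theorem budget_bounds {K T : ℕ} (hK : 3 ≤ K) (h : 1 ≤ pullCount K T) :
    (T : ℝ) / (18 * pullCount K T * Real.log K) ≤ 9 / 4 ∧
    48 * (((3 * roundCount K).choose (hitBound (roundCount K)) : ℝ) *
      (10 / 479) ^ hitBound (roundCount K)) *
      Real.exp (((T : ℝ) / (18 * pullCount K T * Real.log K) - 1) * Real.log 48) ≤
      51 * Real.log K := by
  have hn : (0 : ℝ) < pullCount K T := by exact_mod_cast h
  have hT := le_mul_pullCount_real h
  have hL := log_ge_of_three_le hK
  have h48 : 0 < Real.log 48 := Real.log_pos (by norm_num)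
  have hden : 0 < 18 * pullCount K T * Real.log K := by nlinarith
  rcases hK.eq_or_lt with rfl | hK4
  · rw [roundCount_three] at hT ⊢
    push_cast at hT hL hden ⊢
    have hρ : (T : ℝ) / (18 * pullCount 3 T * Real.log 3) ≤ 17 / 8 := by
      rw [div_le_iff₀ hden]
      nlinarith
    refine ⟨hρ.trans (by norm_num), ?_⟩
    have h1 : Real.exp (((T : ℝ) / (18 * pullCount 3 T * Real.log 3) - 1) * Real.log 48) ≤ 79 := by
      refine (Real.exp_le_exp.mpr ?_).trans exp_nine_eighths_log
      gcongr
      linarith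
    have h2 := choose_hitBound_seven
    refine (mul_le_mul h2 h1 (Real.exp_nonneg _) (by norm_num)).trans ?_
    linarith
  · have hL4 := log_ge_of_four_le hK4
    have hr := roundCount_lt hK
    have hρ : (T : ℝ) / (18 * pullCount K T * Real.log K) ≤ 9 / 4 := by
      rw [div_le_iff₀ hden]
      nlinarith
    refine ⟨hρ, ?_⟩
    have h1 : Real.exp (((T : ℝ) / (18 * pullCount K T * Real.log K) - 1) * Real.log 48) ≤ 127 := by
      refine (Real.exp_le_exp.mpr ?_).trans exp_five_fourths_log
      gcongr
      linarith
    have h2 := choose_hitBound_le_half (nine_le_roundCount hK4)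
    refine (mul_le_mul h2 h1 (Real.exp_nonneg _) (by norm_num)).trans ?_
    linarith

end MTB

end

noncomputable section

namespace MTB

theorem min_abs_mul_sign {ε : ℝ} (hε : 0 < ε) (a : ℝ) :
    min |a| ε * (SignType.sign a : ℝ) = max (-ε) (min a ε) := by
  rcases lt_trichotomy a 0 with h | rfl | h
  · rw [sign_neg h, abs_of_neg h, min_eq_left (by linarith : a ≤ ε), SignType.coe_neg_one,
      mul_neg_one, min_def, max_def]
    split_ifs <;> linarith
  · simp [hε.le]
  · rw [sign_pos h, abs_of_pos h, SignType.coe_one, mul_one,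
      max_eq_right (by linarith [lt_min h hε])]

theorem epsZero_pos {σ : ℝ} {K T : ℕ} (hσ : 0 < σ) (h : 1 ≤ pullCount K T) : 0 < epsZero σ K T := by
  have hn : (0 : ℝ) < pullCount K T := by exact_mod_cast h
  have h48 : 0 < Real.log 48 := Real.log_pos (by norm_num)
  exact Real.sqrt_pos.mpr (by positivity)

theorem pullCount_mul_epsZero_sq {σ : ℝ} {K T : ℕ} (hσ : 0 < σ) (h : 1 ≤ pullCount K T) :
    pullCount K T * epsZero σ K T ^ 2 / (2 * σ ^ 2) = Real.log 48 := by
  have hn : (0 : ℝ) < pullCount K T := by exact_mod_cast h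
  have h48 : 0 < Real.log 48 := Real.log_pos (by norm_num)
  rw [epsZero, Real.sq_sqrt (by positivity)]
  field_simp

theorem hitBound_le {T D N : ℕ} (h : T ≤ D + 2 * N) (hD : 10 * D ≤ 3 * T) : hitBound T ≤ N := by
  unfold hitBound
  omega

theorem one_le_hitBound {T : ℕ} (h : 1 ≤ T) : 1 ≤ hitBound T := by
  unfold hitBound
  omega

/-- The exponent of the rate in terms of the ratio `ρ` of the budget to `18 n L`. -/
theorem rate_eq {T n L σ ε : ℝ} (hn : 0 < n) (hL : 0 < L) (hσ : 0 < σ) :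
    T * ε ^ 2 / (324 * σ ^ 2 * L) = n / (2 * σ ^ 2) * ε ^ 2 * (T / (18 * n * L)) / 9 := by
  field_simp
  ring

theorem rate_sub_le {A ρ e ε : ℝ} (hA : 0 ≤ A) (he : 0 ≤ e) (h3 : 3 * e ≤ ε) (hρ : ρ ≤ 9 / 4) :
    A * ε ^ 2 * ρ / 9 - A * (ε - 2 * e) ^ 2 ≤ (ρ - 1) * (A * e ^ 2) := by
  have h1 : 0 ≤ (ε - e) - 1 / 4 * (ε + 3 * e) := by linarith
  have h2 : 0 ≤ (9 / 4 - ρ) * (ε + 3 * e) := mul_nonneg (by linarith) (by linarith)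
  have h3 : 0 ≤ A * ((ε - 3 * e) * ((ε - e) - ρ / 9 * (ε + 3 * e))) :=
    mul_nonneg hA (mul_nonneg (by linarith) (by linarith))
  linarith

section Main

variable {Ω : Type*} [MeasurableSpace Ω] {P : Measure Ω} [IsProbabilityMeasure P]
  {K : ℕ} [NeZero K] {σ τ ε : ℝ} {T : ℕ} {ν : Fin K → Measure ℝ} {X : ℕ → Fin K → ℕ → Ω → ℝ}
  {sel : Ω → ℕ → Finset (Fin 3) → Fin 3} {khat : Ω → Fin K}

theorem measure_isBad_le_exp_log (hK : 3 ≤ K) (hσ : 0 < σ) (hT₂ : 1 ≤ pullCount K T)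
    (hsub : ∀ k, IsSubGaussian σ (ν k)) (hε : 3 * epsZero σ K T ≤ ε)
    (hcross : Crossing (fun k => armMean ν k - τ) ε) (hX : ∀ t k j, Measurable (X t k j))
    (hlaw : ∀ t k j, P.map (X t k j) = ν k)
    (hindep : iIndepFun (fun q : ℕ × Fin K × ℕ => X q.1 q.2.1 q.2.2) P)
    (hsel : ∀ ω t C, C.Nonempty → sel ω t C ∈ C)
    (hkhat : ∀ ω, IsMTBOutput τ (epsZero σ K T)
      (fun s k => meanVar X (pullCount K T) s k ω) (sel ω) (khat ω)) :
    P.real {ω | IsBad (fun k => armMean ν k - τ) ε (khat ω)} ≤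
      Real.exp (-(3 * Real.log K / 4)) := by
  have he := epsZero_pos hσ hT₂
  have he48 := pullCount_mul_epsZero_sq hσ hT₂
  have hT₁ : 1 ≤ roundCount K := by
    have := six_log_le_roundCount K
    have := log_ge_of_three_le hK
    have h : (0 : ℝ) < roundCount K := by linarith
    exact_mod_cast h
  have hkey := mul_measure_misleads_le (τ := τ) (ε := ε) (W := 1) hσ hsub hX hlaw hindep hT₂ he
    he48 hε le_rfl
    (by
      rw [one_mul, show (1 / 48 : ℝ) = Real.exp (-Real.log 48) by
        rw [Real.exp_neg, Real.exp_log (by norm_num)]; norm_num, ← he48]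
      gcongr
      linarith)
    (roundCount K) (hitBound (roundCount K)) (one_le_hitBound hT₁)
    (S := {ω | IsBad (fun k => armMean ν k - τ) ε (khat ω)})
    (fun ω hω => hitBound_le
      (hcross.le_of_isBad he (by linarith) (hcross.hitSpec he hε) (hsel ω) (hkhat ω) hω)
      (ten_mul_clog_le hK))
    (Or.inl rfl)
  rw [one_mul] at hkey
  exact hkey.trans (choose_hitBound_le_exp K)

theorem measure_isBad_le_rate (hK : 3 ≤ K) (hσ : 0 < σ) (hT₂ : 1 ≤ pullCount K T)
    (hsub : ∀ k, IsSubGaussian σ (ν k)) (hε : 3 * epsZero σ K T ≤ ε)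
    (hcross : Crossing (fun k => armMean ν k - τ) ε) (hX : ∀ t k j, Measurable (X t k j))
    (hlaw : ∀ t k j, P.map (X t k j) = ν k)
    (hindep : iIndepFun (fun q : ℕ × Fin K × ℕ => X q.1 q.2.1 q.2.2) P)
    (hsel : ∀ ω t C, C.Nonempty → sel ω t C ∈ C)
    (hkhat : ∀ ω, IsMTBOutput τ (epsZero σ K T)
      (fun s k => meanVar X (pullCount K T) s k ω) (sel ω) (khat ω)) :
    P.real {ω | IsBad (fun k => armMean ν k - τ) ε (khat ω)} ≤
      72 * Real.log K * Real.exp (-(T * ε ^ 2 / (324 * σ ^ 2 * Real.log K))) := by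
  have he := epsZero_pos hσ hT₂
  have he48 := pullCount_mul_epsZero_sq hσ hT₂
  have hL := log_ge_of_three_le hK
  have hL0 : 0 < Real.log K := by linarith
  have hT₁ : 1 ≤ roundCount K := by
    have := six_log_le_roundCount K
    have h : (0 : ℝ) < roundCount K := by linarith
    exact_mod_cast h
  have hclog : Nat.clog 2 (K - 1) < roundCount K := by
    have := ten_mul_clog_le hK
    omega
  obtain ⟨hρ, hbudget⟩ := budget_bounds hK hT₂
  have hn : (0 : ℝ) < pullCount K T := by exact_mod_cast hT₂
  rw [rate_eq hn hL0 hσ]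
  set n := pullCount K T with hn_def
  set e₀ := epsZero σ K T
  set A : ℝ := n / (2 * σ ^ 2) with hA_def
  set ρ : ℝ := T / (18 * n * Real.log K)
  have hA : 0 < A := by positivity
  have hAe : A * e₀ ^ 2 = Real.log 48 := by rw [← he48, hA_def]; ring
  set R : ℝ := Real.exp (-(A * ε ^ 2 * ρ / 9)) with hR_def
  set m : Ω → ℕ → Fin K → ℝ := fun ω s k => meanVar X n s k ω
  -- an observation off by `ε / 2`
  have hdev : P.real {ω | ∃ t < roundCount K, ∃ i, Deviates (fun k => armMean ν k - τ) τ (ε / 2)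
      ((exploreNode τ (m ω) t).arm i) (m ω t ((exploreNode τ (m ω) t).arm i))} ≤
      21 * Real.log K * R := by
    refine (measure_exists_deviates_le (τ := τ) hσ hsub hX hlaw hindep hT₂ (d := ε / 2)
      (by linarith) (roundCount K)).trans ?_
    have h1 := roundCount_lt hK
    have h2 : n * (ε / 2) ^ 2 / (2 * σ ^ 2) = A * ε ^ 2 / 4 := by rw [hA_def]; ring
    rw [h2]
    refine mul_le_mul (by linarith) (Real.exp_le_exp.mpr ?_) (Real.exp_nonneg _) (by positivity)
    have h3 : A * ε ^ 2 * ρ ≤ A * ε ^ 2 * (9 / 4) := by gcongr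
    linarith
  by_cases hcase : 2 * e₀ ≤ ε / 2
  · refine (measureReal_mono fun ω hω =>
      hcross.exists_deviates_of_isBad he (hsel ω) hclog (hkhat ω) hω (Or.inr hcase)).trans
      (hdev.trans ?_)
    have : 0 ≤ Real.log K * R := by positivity
    linarith
  -- the small parameter, with a far observation off by `ε - 2 * e₀`
  set q : ℝ := Real.exp (-(n * (ε - 2 * e₀) ^ 2 / (2 * σ ^ 2))) with hq_def
  have hq : 0 < q := Real.exp_pos _
  have hq48 : q ≤ 1 / 48 := by
    rw [show (1 / 48 : ℝ) = Real.exp (-Real.log 48) by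
      rw [Real.exp_neg, Real.exp_log (by norm_num)]; norm_num, ← he48, hq_def]
    gcongr
    linarith
  have hfar := mul_measure_misleads_le (τ := τ) (ε := ε) (W := 1 / (48 * q)) hσ hsub hX hlaw hindep
    hT₂ he he48 hε (by rw [le_div_iff₀ (by positivity)]; linarith)
    (by rw [← hq_def]; field_simp; norm_num)
    (roundCount K) (hitBound (roundCount K)) (one_le_hitBound hT₁)
    (S := {ω | IsBad (fun k => armMean ν k - τ) ε (khat ω) ∧ epsHat τ e₀ (m ω) = 2 * e₀})
    (fun ω hω => hitBound_le
      (hcross.le_of_isBad he (by linarith) (hcross.hitSpec he hε) (hsel ω) (hkhat ω) hω.1)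
      (ten_mul_clog_le hK))
    (Or.inr fun ω hω => hcross.exists_far_hit_of_isBad he (by linarith) (hcross.hitSpec he hε)
      (hsel ω) (hkhat ω) hω.1 hω.2)
  have hqR : q ≤ Real.exp ((ρ - 1) * Real.log 48) * R := by
    rw [hq_def, hR_def, ← Real.exp_add]
    apply Real.exp_le_exp.mpr
    have h1 := rate_sub_le hA.le he.le hε hρ
    have h2 : n * (ε - 2 * e₀) ^ 2 / (2 * σ ^ 2) = A * (ε - 2 * e₀) ^ 2 := by rw [hA_def]; ring
    rw [hAe] at h1
    rw [h2]
    linarith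
  set B : ℝ := ((3 * roundCount K).choose (hitBound (roundCount K)) : ℝ) *
    (10 / 479) ^ hitBound (roundCount K)
  have hB : 0 ≤ B := by positivity
  have hfar' : P.real {ω | IsBad (fun k => armMean ν k - τ) ε (khat ω) ∧
      epsHat τ e₀ (m ω) = 2 * e₀} ≤ 51 * Real.log K * R := by
    rw [one_div, inv_mul_le_iff₀ (by positivity)] at hfar
    calc _ ≤ 48 * q * B := hfar
      _ ≤ 48 * (Real.exp ((ρ - 1) * Real.log 48) * R) * B := by gcongr
      _ = 48 * B * Real.exp ((ρ - 1) * Real.log 48) * R := by ring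
      _ ≤ _ := mul_le_mul_of_nonneg_right hbudget (Real.exp_nonneg _)
  refine (measureReal_mono (s₂ := {ω | ∃ t < roundCount K, ∃ i,
      Deviates (fun k => armMean ν k - τ) τ (ε / 2)
        ((exploreNode τ (m ω) t).arm i) (m ω t ((exploreNode τ (m ω) t).arm i))} ∪
      {ω | IsBad (fun k => armMean ν k - τ) ε (khat ω) ∧ epsHat τ e₀ (m ω) = 2 * e₀})
    fun ω hω => ?_).trans ((measureReal_union_le _ _).trans (by linarith))
  by_cases heq : epsHat τ e₀ (m ω) = 2 * e₀
  · exact Or.inr ⟨hω, heq⟩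
  · exact Or.inl
      (hcross.exists_deviates_of_isBad he (hsel ω) hclog (hkhat ω) hω (Or.inl heq))

end Main

end MTB

end

theorem mainTheorem3 {Ω : Type*} [MeasurableSpace Ω] (P : Measure Ω) [IsProbabilityMeasure P]
    {K : ℕ} [NeZero K] (hK : 3 ≤ K) (σ τ : ℝ) (hσ : 0 < σ)
    -- the budget; `T₂ ≥ 1` says that `ε₀` is finite
    (T : ℕ) (hT : 6 * Real.log K < T) (hT₂ : 1 ≤ pullCount K T)
    -- the bandit problem, with `τ` between the means of the first and the last arm
    (ν : Fin K → Measure ℝ) (hν : ∀ k, IsProbabilityMeasure (ν k))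
    (hsub : ∀ k, IsSubGaussian σ (ν k))
    (hτ_left : armMean ν (TreeNode.root K).left ≤ τ)
    (hτ_right : τ ≤ armMean ν (TreeNode.root K).right)
    (ε : ℝ) (hε : 3 * epsZero σ K T ≤ ε)
    (hmono : Monotone fun k : Fin K =>
      min |armMean ν k - τ| ε * (SignType.sign (armMean ν k - τ) : ℝ))
    -- `X t k j` is the `j`-th sample of arm `k` in round `t`
    (X : ℕ → Fin K → ℕ → Ω → ℝ) (hX : ∀ t k j, Measurable (X t k j))
    (hlaw : ∀ t k j, P.map (X t k j) = ν k)
    (hindep : iIndepFun (fun q : ℕ × Fin K × ℕ => X q.1 q.2.1 q.2.2) P)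
    -- ties among the candidates of a round are broken in an arbitrary, possibly random way
    (sel : Ω → ℕ → Finset (Fin 3) → Fin 3)
    (hsel : ∀ ω t C, C.Nonempty → sel ω t C ∈ C)
    (khat : Ω → Fin K)
    (hkhat : ∀ ω, IsMTBOutput τ (epsZero σ K T)
      (empiricalMean (pullCount K T) fun t k j => X t k j ω) (sel ω) (khat ω)) :
    P.real {ω | ε ≤ simpleRegret (armMean ν) τ (thresholdLabel (khat ω))} ≤
      min (Real.exp (-(3 * Real.log K / 4)))
        (72 * Real.log K *
          Real.exp (-(T * ε ^ 2 / (324 * σ ^ 2 * Real.log K)))) := by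
  have hε0 : 0 < ε := by linarith [MTB.epsZero_pos hσ hT₂]
  have hcross : MTB.Crossing (fun k => armMean ν k - τ) ε :=
    { two_le := by omega
      eps_pos := hε0
      mono := by simpa only [MTB.min_abs_mul_sign hε0] using hmono
      first := sub_nonpos.mpr hτ_left
      last := sub_nonneg.mpr hτ_right }
  exact (measureReal_mono fun ω hω => hcross.isBad_of_le_simpleRegret hω).trans (le_min
    (MTB.measure_isBad_le_exp_log hK hσ hT₂ hsub hε hcross hX hlaw hindep hsel hkhat)
    (MTB.measure_isBad_le_rate hK hσ hT₂ hsub hε hcross hX hlaw hindep hsel hkhat))
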